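/- **Setting.** For $d\ge 1$ let $\|\cdot\|$ be the Euclidean norm on $\mathbb R^d$ and $\|\cdot\|_{\rm op}$ the operator norm on $d\times d$ matrices. For $\Delta,L_1,L_2>0$ let $\mathcal F(\Delta,L_1,L_2)$ be the class of all $C^2$ functions $F:\mathbb R^d\to\mathbb R$, $d\ge1$ arbitrary, that are bounded below with $F(0)-\inf F\le\Delta$ and satisfy $\|\nabla F(x)-\nabla F(y)\|\le L_1\|x-y\|$ and $\|\nabla^2F(x)-\nabla^2F(y)\|_{\rm op}\le L_2\|x-y\|$ for all $x,y$. A stochastic second-order oracle for $F$ is a probability distribution $\mathbb P_\xi$ on a measurable space with jointly measurable estimators $\nabla f(x,\xi)\in\mathbb R^d$ and $\nabla^2 f(x,\xi)\in\mathbb R^{d\times d}$ such that $\mathbb E_\xi\nabla f(x,\xi)=\nabla F(x)$ and $\mathbb E_\xi\nabla^2f(x,\xi)=\nabla^2F(x)$ for all $x$; it answers a query $x$ with $(F(x),\nabla f(x,\xi),\nabla^2f(x,\xi))$. Let $\mathcal O(F,\sigma_1^p,\sigma_2^q)$ be the class of those oracles with $p$-bounded central moment (BCM) gradients and $q$-BCM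 Hessians: $\mathbb E_\xi\|\nabla f(x,\xi)-\nabla F(x)\|^p\le\sigma_1^p$ and $\mathbb E_\xi\|\nabla^2 f(x,\xi)-\nabla^2F(x)\|_{\rm op}^q\le\sigma_2^q$ for all $x$. A (randomized) algorithm with batch size $K\ge1$ draws a random seed once; in round $i\ge1$ it queries $K$ points $x^{(i)}_1,\dots,x^{(i)}_K\in\mathbb R^d$, a measurable function of its seed and of the answers of rounds $1,\dots,i-1$, and the oracle answers all $K$ of them with one common fresh independent draw $\xi^{(i)}\sim\mathbb P_\xi$. The support of an answer is the set of indices of the nonzero entries of $\nabla f(x,\xi)$ and of the nonzero rows of $\nabla^2f(x,\xi)$. The algorithm is zero-respecting if, for every $C^2$ function and every stochastic second-order oracle for it, almost surely the support of every query is contained in the union of the supports of all answers of the earlier rounds. Let $\mathcal A_{\rm zr}(K)$ be the class of zero-respecting algorithms, and let $T_\varepsilon(\mathtt A,\mathtt O)$ be the least $T\ge1$ such that $\mathbb E\|\nabla F(x^{(T)}_k)\|\le\varepsilon$ for some $k\in\{1,\dots,K\}$ ($\infty$ if there is none). Put $$\mathfrak m_\varepsilon^{\rm zr}(K,\Delta,L_1,L_2,\sigma_1^p,\sigma_2^q)=\sup_{F\in\mathcal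 F(\Delta,L_1,L_2)}\ \sup_{\mathtt O\in\mathcal O(F,\sigma_1^p,\sigma_2^q)}\ \inf_{\mathtt A\in\mathcal A_{\rm zr}(K)}T_\varepsilon(\mathtt A,\mathtt O),$$ the supremum over $F$ including the supremum over the dimension $d\ge1$. **Theorem.** There is a universal constant $c_1>0$, and for all $p\in(1,2]$ and $q\in[1,2]$ there is a constant $c>0$ depending only on $p$ and $q$, such that the following holds for all $K\ge1$, $\Delta,L_1,L_2>0$, $\sigma_1,\sigma_2\ge0$ and $0<\varepsilon\le c_1\min\{\sqrt{L_1\Delta},\,L_2^{1/3}\Delta^{2/3}\}$. Let $$B=\min\Big\{\tfrac{L_1\Delta}{\varepsilon^2}+\tfrac{L_1\Delta}{\varepsilon^2}\big(\tfrac{\sigma_1}{\varepsilon}\big)^{\frac p{p-1}},\ \tfrac{L_2^{1/2}\Delta}{\varepsilon^{3/2}}+\tfrac{L_2^{1/2}\Delta}{\varepsilon^{3/2}}\big(\tfrac{\sigma_1}{\varepsilon}\big)^{\frac p{p-1}},\ \min\big\{\tfrac{L_1\Delta}{\varepsilon^2},\tfrac{L_2^{1/2}\Delta}{\varepsilon^{3/2}}\big\}+\tfrac{\sigma_2\Delta}{\varepsilon^2}+\tfrac{\sigma_2\Delta}{\varepsilon^2}\big(\tfrac{\sigma_1}{\varepsilon}\big)^{\frac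 p{q(p-1)}}+\big(\tfrac{\sigma_1}{\varepsilon}\big)^{\frac p{p-1}}\Big\}.$$ Then $\mathfrak m_\varepsilon^{\rm zr}(K,\Delta,L_1,L_2,\sigma_1^p,\sigma_2^q)\ge c\,B$. Moreover, for every zero-respecting algorithm $\mathtt A$ with batch size $K$ (given in every dimension) there are a dimension $d\ge1$, a function $F\in\mathcal F(\Delta,L_1,L_2)$ on $\mathbb R^d$ and an oracle $\mathtt O\in\mathcal O(F,\sigma_1^p,\sigma_2^q)$ with $T_\varepsilon(\mathtt A,\mathtt O)\ge c\,B$. -/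

import Mathlib

open MeasureTheory
open scoped ENNReal

universe u

noncomputable section

/-- `ℝ^d` with its Euclidean norm. -/
abbrev Vec (d : ℕ) : Type := EuclideanSpace ℝ (Fin d)

/-- Linear maps `ℝ^d → ℝ^d` (square matrices) with the operator norm. They are not assumed to be
symmetric; the `i`-th row of `H` is the linear form `v ↦ (H v) i`. -/
abbrev Mat (d : ℕ) : Type := Vec d →L[ℝ] Vec d

/-- The Hessian of `F`, as the derivative of the gradient. -/
def hessian {d : ℕ} (F : Vec d → ℝ) (x : Vec d) : Mat d :=
  fderiv ℝ (gradient F) x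

/-- The function class `𝓕(Δ, L₁, L₂)` in dimension `d`. -/
structure SmoothClass {d : ℕ} (Δ L₁ L₂ : ℝ) (F : Vec d → ℝ) : Prop where
  contDiff : ContDiff ℝ 2 F
  bddBelow : BddBelow (Set.range F)
  subopt : F 0 - (⨅ x, F x) ≤ Δ
  lipschitz_gradient : ∀ x y, ‖gradient F x - gradient F y‖ ≤ L₁ * ‖x - y‖
  lipschitz_hessian : ∀ x y, ‖hessian F x - hessian F y‖ ≤ L₂ * ‖x - y‖

/-- A stochastic second-order oracle for `F`: a probability distribution on a measurable space
together with jointly measurable, unbiased estimators of the gradient and of the Hessian. -/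
structure StochOracle {d : ℕ} (F : Vec d → ℝ) : Type 1 where
  Z : Type
  measZ : MeasurableSpace Z
  P : Measure Z
  isProb : IsProbabilityMeasure P
  grad : Vec d → Z → Vec d
  hess : Vec d → Z → Mat d
  measurable_grad : Measurable (Function.uncurry grad)
  measurable_hess : Measurable (Function.uncurry hess)
  integrable_grad : ∀ x, Integrable (grad x) P
  integrable_hess : ∀ x, Integrable (hess x) P
  unbiased_grad : ∀ x, ∫ ξ, grad x ξ ∂P = gradient F x
  unbiased_hess : ∀ x, ∫ ξ, hess x ξ ∂P = hessian F x

attribute [instance] StochOracle.measZ StochOracle.isProb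

/-- `p`-bounded central moment of the stochastic gradients, with constant `σ₁`. -/
def StochOracle.GradBCM {d : ℕ} {F : Vec d → ℝ} (O : StochOracle F) (p σ₁ : ℝ) : Prop :=
  ∀ x, ∫⁻ ξ, ‖O.grad x ξ - gradient F x‖ₑ ^ p ∂O.P ≤ ENNReal.ofReal (σ₁ ^ p)

/-- `q`-bounded central moment of the stochastic Hessians (in operator norm), with constant
`σ₂`. -/
def StochOracle.HessBCM {d : ℕ} {F : Vec d → ℝ} (O : StochOracle F) (q σ₂ : ℝ) : Prop :=
  ∀ x, ∫⁻ ξ, ‖O.hess x ξ - hessian F x‖ₑ ^ q ∂O.P ≤ ENNReal.ofReal (σ₂ ^ q)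

/-- The oracle's answer to one query point: value, gradient estimate, Hessian estimate. -/
abbrev Response (d : ℕ) : Type := ℝ × Vec d × Mat d

/-- The answer `(F x, ∇f(x, ξ), ∇²f(x, ξ))` at the point `x` with the seed `ξ`. -/
def StochOracle.response {d : ℕ} {F : Vec d → ℝ} (O : StochOracle F) (x : Vec d) (ξ : O.Z) :
    Response d :=
  (F x, O.grad x ξ, O.hess x ξ)

/-- The support of an answer: the coordinates at which the gradient estimate is nonzero, and the
indices of the nonzero rows of the Hessian estimate. -/
def Response.supp {d : ℕ} (ρ : Response d) : Set (Fin d) :=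
  {n | ρ.2.1 n ≠ 0} ∪ {n | ∃ v : Vec d, ρ.2.2 v n ≠ 0}

/-- A randomized algorithm on `ℝ^d` that issues a batch of `K` queries per round: a random seed,
drawn once at the beginning, and for each `i` a measurable map that sends the answers of the first
`i` rounds and the seed to the batch of the next round. -/
structure BatchAlgorithm (d K : ℕ) : Type (u + 1) where
  R : Type u
  measR : MeasurableSpace R
  Pr : Measure R
  isProb : IsProbabilityMeasure Pr
  step : (i : ℕ) → (Fin i → Fin K → Response d) → R → Fin K → Vec d
  measurable_step : ∀ i, Measurable (Function.uncurry (step i))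

attribute [instance] BatchAlgorithm.measR BatchAlgorithm.isProb

/-- The batch that the algorithm queries in round `i + 1`, when its seed is `r` and the oracle's
seeds in rounds `1, 2, …` are `ξ 0, ξ 1, …`; within a round the seed is shared by the batch. -/
def BatchAlgorithm.query {d K : ℕ} (A : BatchAlgorithm.{u} d K) {F : Vec d → ℝ}
    (O : StochOracle F) (r : A.R) (ξ : ℕ → O.Z) (i : ℕ) : Fin K → Vec d :=
  A.step i (fun j k => O.response (A.query O r ξ j k) (ξ j)) r
termination_by i
decreasing_by exact j.isLt

/-- The law of all the randomness: the algorithm's seed, and independently of it an i.i.d. sequence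
of oracle seeds. -/
def BatchAlgorithm.law {d K : ℕ} (A : BatchAlgorithm.{u} d K) {F : Vec d → ℝ}
    (O : StochOracle F) : Measure (A.R × (ℕ → O.Z)) :=
  A.Pr.prod (Measure.infinitePi fun _ : ℕ => O.P)

/-- Zero-respecting algorithms: for every `C²` function and every stochastic second-order oracle
for it, almost surely, the support of each query is contained in the union of the supports of all
the answers of the earlier rounds. -/
def BatchAlgorithm.ZeroRespecting {d K : ℕ} (A : BatchAlgorithm.{u} d K) : Prop :=
  ∀ (F : Vec d → ℝ), ContDiff ℝ 2 F → ∀ O : StochOracle F, ∀ᵐ ω ∂A.law O,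
    ∀ (i : ℕ) (k : Fin K),
      {n | A.query O ω.1 ω.2 i k n ≠ 0} ⊆
        ⋃ j : Fin i, ⋃ l : Fin K, (O.response (A.query O ω.1 ω.2 j l) (ω.2 j)).supp

/-- The least number `T ≥ 1` of rounds such that some point `x` of the batch of round `T` satisfies
`𝔼 ‖∇F(x)‖ ≤ ε` (and `∞` if there is none). -/
def BatchAlgorithm.rounds {d K : ℕ} (A : BatchAlgorithm.{u} d K) {F : Vec d → ℝ}
    (O : StochOracle F) (ε : ℝ) : ℝ≥0∞ :=
  ⨅ (i : ℕ) (_ : ∃ k : Fin K,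
      ∫⁻ ω, ‖gradient F (A.query O ω.1 ω.2 i k)‖ₑ ∂A.law O ≤ ENNReal.ofReal ε),
    ((i + 1 : ℕ) : ℝ≥0∞)

/-- The complexity measure `𝔪_ε(K, Δ, L₁, L₂, σ₁^p, σ₂^q)`: the supremum over all dimensions
`d ≥ 1`, functions of the class and admissible oracles of the infimum, over all zero-respecting
algorithms, of the number of rounds. -/
def complexityZR (K : ℕ) (ε Δ L₁ L₂ p q σ₁ σ₂ : ℝ) : ℝ≥0∞ :=
  ⨆ (d : ℕ) (_ : 1 ≤ d) (F : Vec d → ℝ) (_ : SmoothClass Δ L₁ L₂ F) (O : StochOracle F)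
    (_ : O.GradBCM p σ₁ ∧ O.HessBCM q σ₂),
    ⨅ (A : BatchAlgorithm.{u} d K) (_ : A.ZeroRespecting), A.rounds O ε

/-- The expression inside the lower bound. -/
def lowerBoundRate (ε Δ L₁ L₂ p q σ₁ σ₂ : ℝ) : ℝ :=
  min (min
    (L₁ * Δ / ε ^ 2 + L₁ * Δ / ε ^ 2 * (σ₁ / ε) ^ (p / (p - 1)))
    (L₂ ^ (1 / 2 : ℝ) * Δ / ε ^ (3 / 2 : ℝ)
      + L₂ ^ (1 / 2 : ℝ) * Δ / ε ^ (3 / 2 : ℝ) * (σ₁ / ε) ^ (p / (p - 1))))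
    (min (L₁ * Δ / ε ^ 2) (L₂ ^ (1 / 2 : ℝ) * Δ / ε ^ (3 / 2 : ℝ))
      + σ₂ * Δ / ε ^ 2
      + σ₂ * Δ / ε ^ 2 * (σ₁ / ε) ^ (p / (q * (p - 1)))
      + (σ₁ / ε) ^ (p / (p - 1)))

end

/-! The hard function is a chain: its coordinates can only be found one after another, and its
gradient has norm at least `2ε` until the last one is found. The oracle hides the entries of the
gradient and the rows of the Hessian from the first undiscovered coordinate on. It multiplies them
by `1/θ` with probability `θ` and by `0` otherwise, which keeps it unbiased. One coin serves the
whole round, so whatever `K` is, a round finds at most one coordinate, and only on heads. By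
Markov's inequality, the `T` heads needed to finish a chain of length `T` cost at least `T/(2θ)`
rounds (`rounds_ge_of_progress`).

With gradients of order `ε`, the chain has one free length scale `β`. Each link costs about `εβ` of
function value, so `T ≈ Δ/(εβ)`; the Hessian has size about `ε/β` and Lipschitz constant about
`ε/β²`. Smoothness thus requires `β ≳ ε/L₁` and `β ≳ √(ε/L₂)`. The hidden part of the gradient is a
single entry of size at most `2ε`, so the gradient moment allows `1/θ ≈ (σ₁/ε)^(p/(p-1))` whatever
`T` and `β` are. The hidden part of the Hessian is bounded by its full norm, which adds the
requirement `β ≳ ε θ^((1-q)/q)/σ₂`. Depending on which of the three requirements on `β` is binding,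
`T/θ` is one of the products in the rate.

Three instances give the bound: the chain without noise, the noisy chain at the smallest admissible
scale, and a single noisy link, whose hidden Hessian vanishes so that `σ₂` plays no role
(`hasHardInstance_deterministic`, `hasHardInstance_noisy`, `hasHardInstance_short`). The best of
them dominates the rate up to a constant (`hasHardInstance_lowerBoundRate`). -/

noncomputable section

/-! ### Progress of zero-respecting algorithms -/

/-- The number of the first `i` oracle seeds that fall into `B`. -/
def hitCount {Z : Type*} (B : Set Z) (ξ : ℕ → Z) (i : ℕ) : ℕ :=
  open Classical in ∑ j ∈ Finset.range i, if ξ j ∈ B then 1 else 0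

lemma hitCount_succ_of_mem {Z : Type*} {B : Set Z} {ξ : ℕ → Z} {i : ℕ} (h : ξ i ∈ B) :
    hitCount B ξ (i + 1) = hitCount B ξ i + 1 := by
  unfold hitCount
  rw [Finset.sum_range_succ, if_pos h]

lemma hitCount_mono {Z : Type*} (B : Set Z) (ξ : ℕ → Z) : Monotone (hitCount B ξ) := by
  intro i j hij
  classical
  exact Finset.sum_le_sum_of_subset (Finset.range_subset_range.2 hij)

/-- A zero-respecting sequence of batches discovers at most one coordinate per hit. -/
lemma eq_zero_of_hitCount_le {d K : ℕ} {F : Vec d → ℝ} (O : StochOracle F) (B : Set O.Z)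
    (h0 : ∀ (x : Vec d) (ξ : O.Z) (s : ℕ), (∀ n : Fin d, s ≤ n → x n = 0) → ξ ∉ B →
      ∀ n ∈ (O.response x ξ).supp, (n : ℕ) < s)
    (h1 : ∀ (x : Vec d) (ξ : O.Z) (s : ℕ), (∀ n : Fin d, s ≤ n → x n = 0) →
      ∀ n ∈ (O.response x ξ).supp, (n : ℕ) < s + 1)
    (X : ℕ → Fin K → Vec d) (ξ : ℕ → O.Z)
    (hX : ∀ i k, {n | X i k n ≠ 0} ⊆
      ⋃ j : Fin i, ⋃ l : Fin K, (O.response (X j l) (ξ j)).supp) (i : ℕ) :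
    ∀ (k : Fin K) (n : Fin d), hitCount B ξ i ≤ n → X i k n = 0 := by
  induction i using Nat.strong_induction_on with
  | _ i ih =>
    intro k n hn
    by_contra hne
    have := hX i k hne
    simp only [Set.mem_iUnion] at this
    obtain ⟨j, l, hjl⟩ := this
    have hprev := ih j j.isLt l
    -- All batch points of round `j` are supported below the same count, and they share one seed; so
    -- the batch as a whole moves the frontier by at most one, and only on a hit.
    by_cases hB : ξ j ∈ B
    · have h := h1 _ (ξ j) _ hprev n hjl
      rw [← hitCount_succ_of_mem hB] at h
      have := hitCount_mono B ξ (show (j : ℕ) + 1 ≤ i from j.isLt)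
      omega
    · have h := h0 _ (ξ j) _ hprev hB n hjl
      have := hitCount_mono B ξ j.isLt.le
      omega

lemma measurable_hitCount {Z : Type*} [MeasurableSpace Z] {B : Set Z} (hB : MeasurableSet B)
    (i : ℕ) : Measurable fun ξ : ℕ → Z => hitCount B ξ i := by
  classical
  unfold hitCount
  refine Finset.measurable_sum _ fun j _ => ?_
  exact Measurable.ite (measurable_pi_apply j hB) measurable_const measurable_const

/-- Linearity of expectation: only the marginal law of each seed enters, not independence. -/
lemma lintegral_hitCount {Z R : Type*} [MeasurableSpace Z] [MeasurableSpace R]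
    (ν : Measure R) [IsProbabilityMeasure ν] (P : Measure Z) [IsProbabilityMeasure P]
    {B : Set Z} (hB : MeasurableSet B) (i : ℕ) :
    ∫⁻ ω, (hitCount B ω.2 i : ℝ≥0∞) ∂(ν.prod (Measure.infinitePi fun _ : ℕ => P))
      = i * P B := by
  classical
  have key : ∀ j : ℕ, ∫⁻ ω : R × (ℕ → Z), (if ω.2 j ∈ B then (1 : ℝ≥0∞) else 0)
      ∂(ν.prod (Measure.infinitePi fun _ : ℕ => P)) = P B := by
    intro j
    have hm : MeasurePreserving (fun ω : R × (ℕ → Z) => ω.2 j)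
        (ν.prod (Measure.infinitePi fun _ : ℕ => P)) P :=
      (measurePreserving_eval_infinitePi (fun _ : ℕ => P) j).comp measurePreserving_snd
    have : (fun ω : R × (ℕ → Z) => if ω.2 j ∈ B then (1 : ℝ≥0∞) else 0)
        = fun ω => B.indicator 1 ((fun ω : R × (ℕ → Z) => ω.2 j) ω) := by
      ext ω; simp [Set.indicator]
    rw [this, hm.lintegral_comp (measurable_one.indicator hB), lintegral_indicator_one hB]
  simp only [hitCount, Nat.cast_sum, Nat.cast_ite, Nat.cast_one, Nat.cast_zero]
  rw [lintegral_finsetSum]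
  · simp [key]
  · intro j _
    exact Measurable.ite ((measurable_pi_apply j).comp measurable_snd hB) measurable_const
      measurable_const

/-- Lower bound for oracles that advance along the coordinates only on an event of probability at
most `θ`. -/
theorem rounds_ge_of_progress {T K : ℕ} (hT : 1 ≤ T) {F : Vec T → ℝ} (hF : ContDiff ℝ 2 F)
    (O : StochOracle F) {B : Set O.Z} (hB : MeasurableSet B) {θ ε : ℝ} (hθ : 0 < θ) (hε : 0 < ε)
    (hP : O.P B ≤ ENNReal.ofReal θ)
    (h0 : ∀ (x : Vec T) (ξ : O.Z) (s : ℕ), (∀ n : Fin T, s ≤ n → x n = 0) → ξ ∉ B →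
      ∀ n ∈ (O.response x ξ).supp, (n : ℕ) < s)
    (h1 : ∀ (x : Vec T) (ξ : O.Z) (s : ℕ), (∀ n : Fin T, s ≤ n → x n = 0) →
      ∀ n ∈ (O.response x ξ).supp, (n : ℕ) < s + 1)
    (hgrad : ∀ x : Vec T, (∀ n : Fin T, T - 1 ≤ (n : ℕ) → x n = 0) →
      2 * ε ≤ ‖gradient F x‖)
    (A : BatchAlgorithm.{u} T K) (hA : A.ZeroRespecting) :
    ENNReal.ofReal (T / (2 * θ)) ≤ A.rounds O ε := by
  unfold BatchAlgorithm.rounds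
  refine le_iInf₂ fun i hi => ?_
  obtain ⟨k, hk⟩ := hi
  have hT0 : (0 : ℝ) < T := by exact_mod_cast hT
  have hprob : IsProbabilityMeasure (A.law O) := by
    unfold BatchAlgorithm.law; infer_instance
  set S : Set (A.R × (ℕ → O.Z)) := {ω | T ≤ hitCount B ω.2 i} with hS
  have hSm : MeasurableSet S :=
    (measurable_hitCount hB i).comp measurable_snd measurableSet_Ici
  -- Markov's inequality for the number of hits, whose mean is at most `iθ`.
  have hmark : (T : ℝ≥0∞) * A.law O S ≤ ENNReal.ofReal (i * θ) := by
    have h := mul_meas_ge_le_lintegral (μ := A.law O)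
      (f := fun ω => (hitCount B ω.2 i : ℝ≥0∞))
      ((measurable_from_top (f := fun n : ℕ => (n : ℝ≥0∞))).comp
        ((measurable_hitCount hB i).comp measurable_snd)) (T : ℝ≥0∞)
    have hset : {ω : A.R × (ℕ → O.Z) | (T : ℝ≥0∞) ≤ (hitCount B ω.2 i : ℝ≥0∞)} = S := by
      ext ω; simp [hS]
    rw [hset] at h
    refine h.trans ?_
    unfold BatchAlgorithm.law
    rw [lintegral_hitCount _ _ hB, ENNReal.ofReal_mul (by positivity), ENNReal.ofReal_natCast]
    gcongr
  -- With fewer than `T` hits the last coordinate of the query is still zero, so the gradient there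
  -- has norm at least `2ε`.
  have hlow : ENNReal.ofReal (2 * ε) * A.law O Sᶜ
      ≤ ∫⁻ ω, ‖gradient F (A.query O ω.1 ω.2 i k)‖ₑ ∂A.law O := by
    rw [← lintegral_indicator_const hSm.compl]
    refine lintegral_mono_ae ?_
    filter_upwards [hA F hF O] with ω hω
    by_cases hωS : ω ∈ S
    · simp [hωS]
    · have hlt : hitCount B ω.2 i ≤ T - 1 := by
        simp only [hS, Set.mem_ofPred_eq] at hωS; omega
      rw [Set.indicator_of_mem (by exact hωS), ← ofReal_norm]
      refine ENNReal.ofReal_le_ofReal (hgrad _ fun n hn => ?_)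
      exact eq_zero_of_hitCount_le O B h0 h1 (fun i => A.query O ω.1 ω.2 i) ω.2 hω i k n
        (hlt.trans hn)
  have hreal := hlow.trans hk
  have hS1 : A.law O Sᶜ = ENNReal.ofReal (1 - (A.law O).real S) := by
    rw [← probReal_compl_eq_one_sub hSm, ofReal_measureReal]
  have hmark' : (T : ℝ) * (A.law O).real S ≤ i * θ := by
    have : A.law O S = ENNReal.ofReal ((A.law O).real S) := by rw [ofReal_measureReal]
    rw [this, ← ENNReal.ofReal_natCast T, ← ENNReal.ofReal_mul (by positivity)] at hmark
    exact (ENNReal.ofReal_le_ofReal_iff (by positivity)).1 hmark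
  rw [hS1, ← ENNReal.ofReal_mul (by positivity), ENNReal.ofReal_le_ofReal_iff hε.le] at hreal
  -- From `2ε (1 - P(S)) ≤ ε`; with Markov this gives `T/2 ≤ iθ`, which is enough since the round
  -- number is `i + 1`.
  have hhalf : 1 / 2 ≤ (A.law O).real S := by nlinarith
  rw [← ENNReal.ofReal_natCast]
  refine ENNReal.ofReal_le_ofReal ?_
  rw [div_le_iff₀ (by positivity)]
  push_cast
  nlinarith

/-! ### Functions with bounded derivatives -/

/-- Infinitely differentiable functions whose derivatives of orders `1`, `2`, `3` are bounded. -/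
structure TameDeriv {E : Type*} [NormedAddCommGroup E] [NormedSpace ℝ E] (f : E → ℝ) : Prop where
  contDiff : ContDiff ℝ 4 f
  bounded : ∃ C : ℝ, ∀ n ∈ Finset.Icc 1 3, ∀ x, ‖iteratedFDeriv ℝ n f x‖ ≤ C

section Tame

variable {E G : Type*} [NormedAddCommGroup E] [NormedSpace ℝ E]
  [NormedAddCommGroup G] [NormedSpace ℝ G]

lemma TameDeriv.add {f g : E → ℝ} (hf : TameDeriv f) (hg : TameDeriv g) :
    TameDeriv fun x => f x + g x := by
  obtain ⟨C, hC⟩ := hf.bounded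
  obtain ⟨D, hD⟩ := hg.bounded
  refine ⟨hf.contDiff.add hg.contDiff, C + D, fun n hn x => ?_⟩
  have h4 : ((n : ℕ) : WithTop ℕ∞) ≤ 4 := by
    have := (Finset.mem_Icc.1 hn).2
    exact_mod_cast (by omega : n ≤ 4)
  have : iteratedFDeriv ℝ n (fun x => f x + g x) x
      = iteratedFDeriv ℝ n f x + iteratedFDeriv ℝ n g x :=
    iteratedFDeriv_add_apply (hf.contDiff.of_le h4).contDiffAt (hg.contDiff.of_le h4).contDiffAt
  rw [this]
  exact (norm_add_le _ _).trans (add_le_add (hC n hn x) (hD n hn x))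

lemma TameDeriv.neg {f : E → ℝ} (hf : TameDeriv f) : TameDeriv fun x => -f x := by
  obtain ⟨C, hC⟩ := hf.bounded
  refine ⟨hf.contDiff.neg, C, fun n hn x => ?_⟩
  have : iteratedFDeriv ℝ n (fun x => -f x) x = -iteratedFDeriv ℝ n f x :=
    iteratedFDeriv_neg_apply
  rw [this, norm_neg]
  exact hC n hn x

lemma TameDeriv.comp_clm {f : E → ℝ} (hf : TameDeriv f) (L : G →L[ℝ] E) :
    TameDeriv fun x => f (L x) := by
  obtain ⟨C, hC⟩ := hf.bounded
  refine ⟨hf.contDiff.comp L.contDiff, max C 0 * (1 + ‖L‖) ^ 3, fun n hn x => ?_⟩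
  have hn' := Finset.mem_Icc.1 hn
  have h4 : ((n : ℕ) : WithTop ℕ∞) ≤ 4 := by exact_mod_cast (by omega : n ≤ 4)
  have : iteratedFDeriv ℝ n (fun x => f (L x)) x =
      (iteratedFDeriv ℝ n f (L x)).compContinuousLinearMap fun _ => L :=
    L.iteratedFDeriv_comp_right hf.contDiff x h4
  rw [this]
  refine (ContinuousMultilinearMap.norm_compContinuousLinearMap_le _ _).trans ?_
  rw [Finset.prod_const, Finset.card_univ, Fintype.card_fin]
  have h1 : ‖L‖ ^ n ≤ (1 + ‖L‖) ^ 3 :=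
    (pow_le_pow_left₀ (norm_nonneg _) (by linarith) n).trans
      (pow_le_pow_right₀ (by linarith [norm_nonneg L]) hn'.2)
  exact mul_le_mul ((hC n hn _).trans (le_max_left _ _)) h1 (by positivity) (le_max_right _ _)

/-- Leibniz' rule also involves the undifferentiated factors. `TameDeriv` does not bound these,
since the penalty grows linearly, so their bounds are separate hypotheses. -/
lemma TameDeriv.mul {f g : E → ℝ} (hf : TameDeriv f) (hg : TameDeriv g)
    (hf0 : ∃ C, ∀ x, |f x| ≤ C) (hg0 : ∃ C, ∀ x, |g x| ≤ C) :
    TameDeriv fun x => f x * g x := by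
  have aux : ∀ {h : E → ℝ}, TameDeriv h → (∃ C, ∀ x, |h x| ≤ C) →
      ∃ C, 0 ≤ C ∧ ∀ n ≤ 3, ∀ x, ‖iteratedFDeriv ℝ n h x‖ ≤ C := by
    rintro h hh ⟨C0, h0⟩
    obtain ⟨C, hC⟩ := hh.bounded
    refine ⟨max (max C C0) 0, le_max_right _ _, fun n hn x => ?_⟩
    rcases Nat.eq_zero_or_pos n with rfl | hpos
    · rw [norm_iteratedFDeriv_zero, Real.norm_eq_abs]
      exact (h0 x).trans ((le_max_right _ _).trans (le_max_left _ _))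
    · exact (hC n (Finset.mem_Icc.2 ⟨hpos, hn⟩) x).trans
        ((le_max_left _ _).trans (le_max_left _ _))
  obtain ⟨C, hC0, hC⟩ := aux hf hf0
  obtain ⟨D, hD0, hD⟩ := aux hg hg0
  refine ⟨hf.contDiff.mul hg.contDiff, 8 * (C * D), fun n hn x => ?_⟩
  have hn' := Finset.mem_Icc.1 hn
  have h4 : ((n : ℕ) : WithTop ℕ∞) ≤ 4 := by exact_mod_cast (by omega : n ≤ 4)
  refine (norm_iteratedFDeriv_mul_le hf.contDiff hg.contDiff x h4).trans ?_
  calc ∑ i ∈ Finset.range (n + 1), (n.choose i : ℝ) * ‖iteratedFDeriv ℝ i f x‖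
        * ‖iteratedFDeriv ℝ (n - i) g x‖
      ≤ ∑ i ∈ Finset.range (n + 1), (n.choose i : ℝ) * (C * D) := by
        refine Finset.sum_le_sum fun i hi => ?_
        have := Finset.mem_range.1 hi
        rw [mul_assoc]
        exact mul_le_mul_of_nonneg_left (mul_le_mul (hC i (by omega) x) (hD _ (by omega) x)
          (norm_nonneg _) hC0) (by positivity)
    _ = 2 ^ n * (C * D) := by
        rw [← Finset.sum_mul]
        congr 1
        exact_mod_cast Nat.sum_range_choose n
    _ ≤ 8 * (C * D) := by
        refine mul_le_mul_of_nonneg_right ?_ (by positivity)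
        calc (2 : ℝ) ^ n ≤ 2 ^ 3 := pow_le_pow_right₀ (by norm_num) hn'.2
          _ = 8 := by norm_num

/-- Mean value inequality, with the bounds on the derivatives of orders `2` and `3`. -/
lemma TameDeriv.lipschitz_fderiv {f : E → ℝ} (hf : TameDeriv f) :
    ∃ C : ℝ, 0 ≤ C ∧ (∀ x y, ‖fderiv ℝ f x - fderiv ℝ f y‖ ≤ C * ‖x - y‖) ∧
      ∀ x y, ‖fderiv ℝ (fderiv ℝ f) x - fderiv ℝ (fderiv ℝ f) y‖ ≤ C * ‖x - y‖ := by
  obtain ⟨C, hC⟩ := hf.bounded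
  have h1 : ContDiff ℝ 3 (fderiv ℝ f) := hf.contDiff.fderiv_right (by norm_num)
  have h2 : ContDiff ℝ 2 (fderiv ℝ (fderiv ℝ f)) := h1.fderiv_right (by norm_num)
  refine ⟨C, (norm_nonneg _).trans (hC 1 (by simp) 0), fun x y => ?_, fun x y => ?_⟩
  · refine Convex.norm_image_sub_le_of_norm_fderiv_le (𝕜 := ℝ) (s := Set.univ)
      (fun z _ => h1.differentiable (by norm_num) z) (fun z _ => ?_) convex_univ trivial trivial
    rw [← norm_iteratedFDeriv_one, norm_iteratedFDeriv_fderiv]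
    exact hC 2 (by simp) z
  · refine Convex.norm_image_sub_le_of_norm_fderiv_le (𝕜 := ℝ) (s := Set.univ)
      (fun z _ => h2.differentiable (by norm_num) z) (fun z _ => ?_) convex_univ trivial trivial
    rw [← norm_iteratedFDeriv_one, norm_iteratedFDeriv_fderiv, norm_iteratedFDeriv_fderiv]
    exact hC 3 (by simp) z

/-- Compactness bounds orders `2` and `3`. The first derivative gets its own hypothesis because that
of the penalty tends to `-1`, not to `0`, at `-∞`. -/
lemma tameDeriv_of_hasCompactSupport {f : ℝ → ℝ} (hf : ContDiff ℝ 4 f)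
    (hb : ∃ C, ∀ x, |deriv f x| ≤ C) (hs : HasCompactSupport (deriv (deriv f))) :
    TameDeriv f := by
  have h1 : ContDiff ℝ 3 (deriv f) := ((contDiff_succ_iff_deriv (n := 3)).1 hf).2.2
  have h2 : ContDiff ℝ 2 (deriv (deriv f)) := ((contDiff_succ_iff_deriv (n := 2)).1 h1).2.2
  have h3 : Continuous (deriv (deriv (deriv f))) :=
    ((contDiff_succ_iff_deriv (n := 1)).1 h2).2.2.continuous
  obtain ⟨C1, hC1⟩ := hb
  obtain ⟨C2, hC2⟩ := hs.exists_bound_of_continuous h2.continuous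
  obtain ⟨C3, hC3⟩ := hs.deriv.exists_bound_of_continuous h3
  refine ⟨hf, max C1 (max C2 C3), fun n hn x => ?_⟩
  have hn' := Finset.mem_Icc.1 hn
  rw [norm_iteratedFDeriv_eq_norm_iteratedDeriv]
  obtain rfl | rfl | rfl : n = 1 ∨ n = 2 ∨ n = 3 := by omega
  · rw [iteratedDeriv_one]
    exact (hC1 x).trans (le_max_left _ _)
  · rw [iteratedDeriv_succ', iteratedDeriv_one]
    exact (hC2 x).trans ((le_max_left _ _).trans (le_max_right _ _))
  · rw [iteratedDeriv_succ', iteratedDeriv_succ', iteratedDeriv_one]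
    exact (hC3 x).trans ((le_max_right _ _).trans (le_max_right _ _))

end Tame

/-! ### One-dimensional building blocks -/

/-- A smooth step from `0` on `(-∞, 1/2]` to `1` on `[1, ∞)`. -/
def chainStep (a : ℝ) : ℝ := Real.smoothTransition (2 * a - 1)

/-- A smooth bump, equal to `1` on `[-2, 1]` and to `0` outside `[-3, 2]`. -/
def chainBump (b : ℝ) : ℝ := Real.smoothTransition (b + 3) * Real.smoothTransition (2 - b)

/-- The increasing primitive of the bump. -/
def chainRamp (b : ℝ) : ℝ := ∫ t in Set.Iic b, chainBump t

/-- The slope of the penalty for negative coordinates: `-1` on `(-∞, -2]`, `0` on `[-1, ∞)`. -/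
def penaltySlope (b : ℝ) : ℝ := Real.smoothTransition (b + 2) - 1

/-- The penalty for negative coordinates. -/
def penalty (b : ℝ) : ℝ := ∫ t in (0 : ℝ)..b, penaltySlope t

lemma contDiff_chainStep {n : ℕ∞} : ContDiff ℝ n chainStep :=
  Real.smoothTransition.contDiff.comp (by fun_prop)

lemma contDiff_chainBump {n : ℕ∞} : ContDiff ℝ n chainBump :=
  (Real.smoothTransition.contDiff.comp (by fun_prop)).mul
    (Real.smoothTransition.contDiff.comp (by fun_prop))

lemma contDiff_penaltySlope {n : ℕ∞} : ContDiff ℝ n penaltySlope :=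
  (Real.smoothTransition.contDiff.comp (by fun_prop)).sub contDiff_const

lemma chainStep_nonneg (a : ℝ) : 0 ≤ chainStep a := Real.smoothTransition.nonneg _

lemma chainStep_le_one (a : ℝ) : chainStep a ≤ 1 := Real.smoothTransition.le_one _

lemma chainStep_of_le {a : ℝ} (h : a ≤ 1 / 2) : chainStep a = 0 :=
  Real.smoothTransition.zero_of_nonpos (by linarith)

lemma chainStep_of_ge {a : ℝ} (h : 1 ≤ a) : chainStep a = 1 :=
  Real.smoothTransition.one_of_one_le (by linarith)

lemma deriv_chainStep_nonneg (a : ℝ) : 0 ≤ deriv chainStep a :=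
  Monotone.deriv_nonneg fun _ _ h => Real.smoothTransition.monotone (by linarith)

lemma deriv_chainStep_of_lt {a : ℝ} (h : a < 1 / 2) : deriv chainStep a = 0 := by
  have : chainStep =ᶠ[nhds a] fun _ => 0 := by
    filter_upwards [Iio_mem_nhds h] with t ht
    exact chainStep_of_le (le_of_lt ht)
  rw [this.deriv_eq, deriv_const]

lemma deriv_chainStep_of_gt {a : ℝ} (h : 1 < a) : deriv chainStep a = 0 := by
  have : chainStep =ᶠ[nhds a] fun _ => 1 := by
    filter_upwards [Ioi_mem_nhds h] with t ht
    exact chainStep_of_ge (le_of_lt ht)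
  rw [this.deriv_eq, deriv_const]

lemma chainBump_nonneg (b : ℝ) : 0 ≤ chainBump b :=
  mul_nonneg (Real.smoothTransition.nonneg _) (Real.smoothTransition.nonneg _)

lemma chainBump_le_one (b : ℝ) : chainBump b ≤ 1 :=
  mul_le_one₀ (Real.smoothTransition.le_one _) (Real.smoothTransition.nonneg _)
    (Real.smoothTransition.le_one _)

lemma chainBump_eq_one {b : ℝ} (h : -2 ≤ b) (h' : b ≤ 1) : chainBump b = 1 := by
  rw [chainBump, Real.smoothTransition.one_of_one_le (by linarith),
    Real.smoothTransition.one_of_one_le (by linarith), one_mul]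

lemma hasCompactSupport_chainBump : HasCompactSupport chainBump := by
  refine HasCompactSupport.intro (isCompact_Icc (a := (-3 : ℝ)) (b := 2)) fun x hx => ?_
  rw [Set.mem_Icc, not_and_or, not_le, not_le] at hx
  rcases hx with hx | hx
  · rw [chainBump, Real.smoothTransition.zero_of_nonpos (by linarith), zero_mul]
  · rw [chainBump, Real.smoothTransition.zero_of_nonpos (x := 2 - x) (by linarith), mul_zero]

lemma integrable_chainBump : Integrable chainBump :=
  (contDiff_chainBump (n := 0)).continuous.integrable_of_hasCompactSupport
    hasCompactSupport_chainBump

lemma hasDerivAt_chainRamp (b : ℝ) : HasDerivAt chainRamp (chainBump b) b := by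
  have h : chainRamp = fun b => (∫ t in Set.Iic 0, chainBump t) + ∫ t in (0 : ℝ)..b, chainBump t := by
    ext b
    rw [← intervalIntegral.integral_Iic_sub_Iic integrable_chainBump.integrableOn
      integrable_chainBump.integrableOn, chainRamp]
    ring
  rw [h]
  exact ((contDiff_chainBump (n := 0)).continuous.integral_hasStrictDerivAt 0 b).hasDerivAt.const_add
    _

lemma deriv_chainRamp : deriv chainRamp = chainBump :=
  funext fun b => (hasDerivAt_chainRamp b).deriv

lemma chainRamp_nonneg (b : ℝ) : 0 ≤ chainRamp b :=
  setIntegral_nonneg measurableSet_Iic fun t _ => chainBump_nonneg t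

lemma chainRamp_le (b : ℝ) : chainRamp b ≤ ∫ t, chainBump t :=
  setIntegral_le_integral integrable_chainBump (ae_of_all _ chainBump_nonneg)

lemma penaltySlope_nonpos (b : ℝ) : penaltySlope b ≤ 0 := by
  unfold penaltySlope; linarith [Real.smoothTransition.le_one (b + 2)]

lemma neg_one_le_penaltySlope (b : ℝ) : -1 ≤ penaltySlope b := by
  unfold penaltySlope; linarith [Real.smoothTransition.nonneg (b + 2)]

lemma penaltySlope_of_ge {b : ℝ} (h : -1 ≤ b) : penaltySlope b = 0 := by
  rw [penaltySlope, Real.smoothTransition.one_of_one_le (by linarith), sub_self]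

lemma penaltySlope_of_le {b : ℝ} (h : b ≤ -2) : penaltySlope b = -1 := by
  rw [penaltySlope, Real.smoothTransition.zero_of_nonpos (by linarith), zero_sub]

lemma hasDerivAt_penalty (b : ℝ) : HasDerivAt penalty (penaltySlope b) b :=
  ((contDiff_penaltySlope (n := 0)).continuous.integral_hasStrictDerivAt 0 b).hasDerivAt

lemma deriv_penalty : deriv penalty = penaltySlope :=
  funext fun b => (hasDerivAt_penalty b).deriv

lemma penalty_zero : penalty 0 = 0 := intervalIntegral.integral_same

lemma penalty_nonneg (b : ℝ) : 0 ≤ penalty b := by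
  rcases le_total 0 b with h | h
  · refine intervalIntegral.integral_nonneg h fun t ht => ?_
    rw [penaltySlope_of_ge (by linarith [ht.1])]
  · rw [penalty, intervalIntegral.integral_symm, ← intervalIntegral.integral_neg]
    exact intervalIntegral.integral_nonneg h fun t _ => by linarith [penaltySlope_nonpos t]

lemma tameDeriv_chainStep : TameDeriv chainStep := by
  have hs : HasCompactSupport (deriv chainStep) := by
    refine HasCompactSupport.intro (isCompact_Icc (a := (0 : ℝ)) (b := 1)) fun x hx => ?_
    rw [Set.mem_Icc, not_and_or, not_le, not_le] at hx
    rcases hx with hx | hx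
    · exact deriv_chainStep_of_lt (by linarith)
    · exact deriv_chainStep_of_gt hx
  refine tameDeriv_of_hasCompactSupport (contDiff_chainStep (n := 4)) ?_ hs.deriv
  exact hs.exists_bound_of_continuous
    ((contDiff_succ_iff_deriv (n := 3)).1 (contDiff_chainStep (n := 4))).2.2.continuous

lemma tameDeriv_chainRamp : TameDeriv chainRamp := by
  have hc : ContDiff ℝ 4 chainRamp := by
    refine (contDiff_succ_iff_deriv (n := 3)).2
      ⟨fun b => (hasDerivAt_chainRamp b).differentiableAt, by simp, ?_⟩
    rw [deriv_chainRamp]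
    exact contDiff_chainBump (n := 3)
  refine tameDeriv_of_hasCompactSupport hc ⟨1, fun x => ?_⟩ ?_
  · rw [deriv_chainRamp, abs_of_nonneg (chainBump_nonneg x)]
    exact chainBump_le_one x
  · rw [deriv_chainRamp]
    exact hasCompactSupport_chainBump.deriv

lemma tameDeriv_penalty : TameDeriv penalty := by
  have hc : ContDiff ℝ 4 penalty := by
    refine (contDiff_succ_iff_deriv (n := 3)).2
      ⟨fun b => (hasDerivAt_penalty b).differentiableAt, by simp, ?_⟩
    rw [deriv_penalty]
    exact contDiff_penaltySlope (n := 3)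
  refine tameDeriv_of_hasCompactSupport hc ⟨1, fun x => ?_⟩ ?_
  · rw [deriv_penalty]
    exact abs_le.2 ⟨neg_one_le_penaltySlope x, (penaltySlope_nonpos x).trans zero_le_one⟩
  · rw [deriv_penalty]
    refine HasCompactSupport.intro (isCompact_Icc (a := (-2 : ℝ)) (b := -1)) fun x hx => ?_
    rw [Set.mem_Icc, not_and_or, not_le, not_le] at hx
    rcases hx with hx | hx
    · have : penaltySlope =ᶠ[nhds x] fun _ => -1 := by
        filter_upwards [Iio_mem_nhds hx] with t ht
        exact penaltySlope_of_le (le_of_lt ht)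
      rw [this.deriv_eq, deriv_const]
    · have : penaltySlope =ᶠ[nhds x] fun _ => 0 := by
        filter_upwards [Ioi_mem_nhds hx] with t ht
        exact penaltySlope_of_ge (le_of_lt ht)
      rw [this.deriv_eq, deriv_const]

/-! ### Smoothness of sums of functions of few coordinates -/

section SumOfRestrictions

variable {ι V E : Type*} [Fintype ι] [NormedAddCommGroup V] [NormedSpace ℝ V]
  [NormedAddCommGroup E] [NormedSpace ℝ E] {P : ι → V →L[ℝ] E} {g : ι → E → ℝ}

lemma hasFDerivAt_sum_comp (hg : ∀ i, ContDiff ℝ 2 (g i)) (x : V) :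
    HasFDerivAt (fun x => ∑ i, g i (P i x)) (∑ i, (fderiv ℝ (g i) (P i x)).comp (P i)) x :=
  HasFDerivAt.fun_sum fun i _ =>
    ((hg i).differentiable (by norm_num) (P i x)).hasFDerivAt.comp x (P i).hasFDerivAt

lemma fderiv_sum_comp (hg : ∀ i, ContDiff ℝ 2 (g i)) :
    fderiv ℝ (fun x => ∑ i, g i (P i x)) =
      fun x => ∑ i, (fderiv ℝ (g i) (P i x)).comp (P i) :=
  funext fun x => (hasFDerivAt_sum_comp hg x).fderiv

lemma fderiv_fderiv_sum_comp (hg : ∀ i, ContDiff ℝ 2 (g i)) (x u v : V) :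
    fderiv ℝ (fderiv ℝ fun x => ∑ i, g i (P i x)) x u v =
      ∑ i, fderiv ℝ (fderiv ℝ (g i)) (P i x) (P i u) (P i v) := by
  rw [fderiv_sum_comp hg]
  have h : HasFDerivAt (fun x => ∑ i, (fderiv ℝ (g i) (P i x)).comp (P i))
      (∑ i, ((ContinuousLinearMap.compL ℝ V E ℝ).flip (P i)).comp
        ((fderiv ℝ (fderiv ℝ (g i)) (P i x)).comp (P i))) x := by
    refine HasFDerivAt.fun_sum fun i _ => ?_
    have h1 : ContDiff ℝ 1 (fderiv ℝ (g i)) := (hg i).fderiv_right (by norm_num)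
    exact ((ContinuousLinearMap.compL ℝ V E ℝ).flip (P i)).hasFDerivAt.comp x
      ((h1.differentiable (by norm_num) (P i x)).hasFDerivAt.comp x (P i).hasFDerivAt)
  rw [h.fderiv]
  simp

lemma sum_norm_mul_norm_le (hP : ∀ v, ∑ i, ‖P i v‖ ^ 2 ≤ 2 * ‖v‖ ^ 2) (u v : V) :
    ∑ i, ‖P i u‖ * ‖P i v‖ ≤ 2 * ‖u‖ * ‖v‖ := by
  have h := Finset.sum_mul_sq_le_sq_mul_sq Finset.univ (fun i => ‖P i u‖) (fun i => ‖P i v‖)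
  refine (sq_le_sq₀ (Finset.sum_nonneg fun _ _ => by positivity) (by positivity)).1 ?_
  calc _ ≤ _ := h
    _ ≤ (2 * ‖u‖ ^ 2) * (2 * ‖v‖ ^ 2) :=
      mul_le_mul (hP u) (hP v) (Finset.sum_nonneg fun _ _ => by positivity) (by positivity)
    _ = _ := by ring

lemma norm_apply_le_two_mul (hP : ∀ v, ∑ i, ‖P i v‖ ^ 2 ≤ 2 * ‖v‖ ^ 2) (i : ι) (v : V) :
    ‖P i v‖ ≤ 2 * ‖v‖ := by
  refine (sq_le_sq₀ (norm_nonneg _) (by positivity)).1 ?_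
  calc ‖P i v‖ ^ 2 ≤ ∑ i, ‖P i v‖ ^ 2 :=
        Finset.single_le_sum (f := fun i => ‖P i v‖ ^ 2) (fun _ _ => by positivity)
          (Finset.mem_univ i)
    _ ≤ 2 * ‖v‖ ^ 2 := hP v
    _ ≤ (2 * ‖v‖) ^ 2 := by nlinarith [sq_nonneg ‖v‖]

/-- Cauchy–Schwarz over the summands replaces the triangle inequality, so the constant does not
depend on their number. -/
lemma lipschitz_fderiv_sum_comp (hg : ∀ i, ContDiff ℝ 2 (g i))
    (hP : ∀ v, ∑ i, ‖P i v‖ ^ 2 ≤ 2 * ‖v‖ ^ 2) {C : ℝ} (hC0 : 0 ≤ C)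
    (hC : ∀ i x y, ‖fderiv ℝ (g i) x - fderiv ℝ (g i) y‖ ≤ C * ‖x - y‖) (x y : V) :
    ‖fderiv ℝ (fun x => ∑ i, g i (P i x)) x - fderiv ℝ (fun x => ∑ i, g i (P i x)) y‖
      ≤ 2 * C * ‖x - y‖ := by
  refine ContinuousLinearMap.opNorm_le_bound _ (by positivity) fun v => ?_
  rw [fderiv_sum_comp hg, ← Finset.sum_sub_distrib, sum_apply]
  calc _ ≤ ∑ i, C * (‖P i (x - y)‖ * ‖P i v‖) := by
        refine norm_sum_le_of_le _ fun i _ => ?_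
        have : ((fderiv ℝ (g i) (P i x)).comp (P i) - (fderiv ℝ (g i) (P i y)).comp (P i)) v
          = (fderiv ℝ (g i) (P i x) - fderiv ℝ (g i) (P i y)) (P i v) := rfl
        rw [this, ← mul_assoc, map_sub]
        exact ContinuousLinearMap.le_of_opNorm_le _ (hC i _ _) _
    _ ≤ C * (2 * ‖x - y‖ * ‖v‖) := by
        rw [← Finset.mul_sum]
        exact mul_le_mul_of_nonneg_left (sum_norm_mul_norm_le hP _ _) hC0
    _ = _ := by ring

lemma lipschitz_fderiv_fderiv_sum_comp (hg : ∀ i, ContDiff ℝ 2 (g i))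
    (hP : ∀ v, ∑ i, ‖P i v‖ ^ 2 ≤ 2 * ‖v‖ ^ 2) {C : ℝ} (hC0 : 0 ≤ C)
    (hC : ∀ i x y, ‖fderiv ℝ (fderiv ℝ (g i)) x - fderiv ℝ (fderiv ℝ (g i)) y‖ ≤ C * ‖x - y‖)
    (x y : V) :
    ‖fderiv ℝ (fderiv ℝ fun x => ∑ i, g i (P i x)) x
        - fderiv ℝ (fderiv ℝ fun x => ∑ i, g i (P i x)) y‖ ≤ 4 * C * ‖x - y‖ := by
  refine ContinuousLinearMap.opNorm_le_bound₂ _ (by positivity) fun u v => ?_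
  rw [sub_apply, sub_apply, fderiv_fderiv_sum_comp hg, fderiv_fderiv_sum_comp hg,
    ← Finset.sum_sub_distrib]
  -- Only two of the three factors are needed for Cauchy–Schwarz; the third is bounded uniformly in
  -- `i`.
  calc _ ≤ ∑ i, C * (2 * ‖x - y‖) * (‖P i u‖ * ‖P i v‖) := by
        refine norm_sum_le_of_le _ fun i _ => ?_
        rw [← sub_apply, ← sub_apply, ← mul_assoc]
        refine ContinuousLinearMap.le_of_opNorm₂_le_of_le _ ?_ le_rfl le_rfl
        refine (hC i _ _).trans (mul_le_mul_of_nonneg_left ?_ hC0)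
        rw [← map_sub]
        exact norm_apply_le_two_mul hP i _
    _ ≤ C * (2 * ‖x - y‖) * (2 * ‖u‖ * ‖v‖) := by
        rw [← Finset.mul_sum]
        exact mul_le_mul_of_nonneg_left (sum_norm_mul_norm_le hP _ _) (by positivity)
    _ = _ := by ring

end SumOfRestrictions

/-! ### Gradients and Hessians in coordinates -/

lemma gradient_apply {d : ℕ} (F : Vec d → ℝ) (x : Vec d) (n : Fin d) :
    gradient F x n = fderiv ℝ F x (EuclideanSpace.single n 1) := by
  have h : inner ℝ (gradient F x) (EuclideanSpace.single n (1 : ℝ))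
      = fderiv ℝ F x (EuclideanSpace.single n 1) := by
    rw [gradient, InnerProductSpace.toDual_symm_apply]
  rw [← h, EuclideanSpace.inner_single_right]
  simp

lemma norm_gradient_sub {d : ℕ} (F : Vec d → ℝ) (x y : Vec d) :
    ‖gradient F x - gradient F y‖ = ‖fderiv ℝ F x - fderiv ℝ F y‖ := by
  rw [gradient, gradient, ← map_sub, LinearIsometryEquiv.norm_map]

lemma contDiff_gradient {d : ℕ} {F : Vec d → ℝ} (hF : ContDiff ℝ 2 F) :
    ContDiff ℝ 1 (gradient F) :=
  (InnerProductSpace.toDual ℝ (Vec d)).symm.contDiff.comp (hF.fderiv_right (by norm_num))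

lemma hessian_eq {d : ℕ} {F : Vec d → ℝ} (hF : ContDiff ℝ 2 F) (x v : Vec d) :
    hessian F x v = (InnerProductSpace.toDual ℝ (Vec d)).symm (fderiv ℝ (fderiv ℝ F) x v) := by
  have h1 : ContDiff ℝ 1 (fderiv ℝ F) := hF.fderiv_right (by norm_num)
  have h := (InnerProductSpace.toDual ℝ (Vec d)).symm.toContinuousLinearEquiv.hasFDerivAt.comp x
    (h1.differentiable (by norm_num) x).hasFDerivAt
  have h' : hessian F x = _ := h.fderiv
  rw [h']
  rfl

lemma norm_hessian_sub_le {d : ℕ} {F : Vec d → ℝ} (hF : ContDiff ℝ 2 F) (x y : Vec d) :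
    ‖hessian F x - hessian F y‖ ≤ ‖fderiv ℝ (fderiv ℝ F) x - fderiv ℝ (fderiv ℝ F) y‖ := by
  refine ContinuousLinearMap.opNorm_le_bound _
    (norm_nonneg (fderiv ℝ (fderiv ℝ F) x - fderiv ℝ (fderiv ℝ F) y)) fun v => ?_
  rw [sub_apply, hessian_eq hF, hessian_eq hF, ← map_sub, LinearIsometryEquiv.norm_map,
    ← sub_apply]
  exact ContinuousLinearMap.le_opNorm _ _

/-- A row of the Hessian is the derivative of one coordinate of the gradient, here locally constant.
-/
lemma hessian_apply_eq_zero {d : ℕ} {F : Vec d → ℝ} (hF : ContDiff ℝ 2 F) {x : Vec d} {n : Fin d}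
    {c : ℝ} (h : (fun y => gradient F y n) =ᶠ[nhds x] fun _ => c) (v : Vec d) :
    hessian F x v n = 0 := by
  have h1 := ((contDiff_gradient hF).differentiable (by norm_num) x).hasFDerivAt
  have h2 := (EuclideanSpace.proj (𝕜 := ℝ) n).hasFDerivAt.comp x h1
  have h3 : HasFDerivAt (fun y => gradient F y n) (0 : Vec d →L[ℝ] ℝ) x :=
    (hasFDerivAt_const c x).congr_of_eventuallyEq h
  have h4 := h2.unique h3
  exact congrArg (fun L : Vec d →L[ℝ] ℝ => L v) h4

/-! ### The chain function -/

/-- A function on `ℝ^T` of which second-order information at points supported in the first `s`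
coordinates only reveals the next coordinate, and whose gradient is large until the last coordinate
is found. -/
structure ZeroChain {T : ℕ} (Δ a L₁ L₂ : ℝ) (F : Vec T → ℝ) : Prop where
  contDiff : ContDiff ℝ 2 F
  lower : ∀ x, F 0 - F x ≤ Δ
  lipschitz_gradient : ∀ x y, ‖gradient F x - gradient F y‖ ≤ L₁ * ‖x - y‖
  lipschitz_hessian : ∀ x y, ‖hessian F x - hessian F y‖ ≤ L₂ * ‖x - y‖
  le_norm_gradient : ∀ x : Vec T, (∀ n : Fin T, T - 1 ≤ (n : ℕ) → x n = 0) →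
    a ≤ ‖gradient F x‖
  gradient_eq_zero : ∀ (x : Vec T) (s : ℕ), (∀ n : Fin T, s ≤ n → x n = 0) →
    ∀ n : Fin T, s + 1 ≤ n → gradient F x n = 0
  hessian_eq_zero : ∀ (x : Vec T) (s : ℕ), (∀ n : Fin T, s ≤ n → x n = 0) →
    ∀ n : Fin T, s + 1 ≤ n → ∀ v, hessian F x v n = 0
  abs_gradient_le : ∀ (x : Vec T) (n : Fin T), x n = 0 → |gradient F x n| ≤ a
  hessian_zero : T = 1 → hessian F 0 = 0

/-- The weight of a link of the chain; the first link is always active. -/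
def chainGate (i : ℕ) (a : ℝ) : ℝ := if i = 0 then 1 else chainStep a

/-- A link of the chain. -/
def chainLink (i : ℕ) (z : ℝ × ℝ) : ℝ := -(chainGate i z.1 * chainRamp z.2) + penalty z.2

/-- The coordinate before the `i`-th one, as a linear form; it is `0` for the first one. -/
def prevCoord {T : ℕ} (i : Fin T) : Vec T →L[ℝ] ℝ :=
  if (i : ℕ) = 0 then 0 else EuclideanSpace.proj ⟨i - 1, (Nat.sub_le _ _).trans_lt i.isLt⟩

/-- The chain function. -/
def chainFun (T : ℕ) (x : Vec T) : ℝ :=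
  ∑ i : Fin T, chainLink i ((prevCoord i).prod (EuclideanSpace.proj i) x)

lemma tameDeriv_chainGate (i : ℕ) : TameDeriv (chainGate i) := by
  unfold chainGate
  split_ifs
  · refine ⟨contDiff_const, 0, fun n hn x => ?_⟩
    have hn' := Finset.mem_Icc.1 hn
    rw [iteratedFDeriv_const_of_ne (by omega)]
    simp
  · exact tameDeriv_chainStep

lemma chainGate_nonneg (i : ℕ) (a : ℝ) : 0 ≤ chainGate i a := by
  unfold chainGate
  split_ifs
  exacts [zero_le_one, chainStep_nonneg a]

lemma chainGate_le_one (i : ℕ) (a : ℝ) : chainGate i a ≤ 1 := by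
  unfold chainGate
  split_ifs
  exacts [le_rfl, chainStep_le_one a]

lemma tameDeriv_chainLink (i : ℕ) : TameDeriv (chainLink i) := by
  have h1 := (tameDeriv_chainGate i).comp_clm (ContinuousLinearMap.fst ℝ ℝ ℝ)
  have h2 := tameDeriv_chainRamp.comp_clm (ContinuousLinearMap.snd ℝ ℝ ℝ)
  have h3 := tameDeriv_penalty.comp_clm (ContinuousLinearMap.snd ℝ ℝ ℝ)
  refine ((h1.mul h2 ⟨1, fun x => ?_⟩ ⟨∫ t, chainBump t, fun x => ?_⟩).neg).add h3
  · rw [abs_of_nonneg (chainGate_nonneg _ _)]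
    exact chainGate_le_one _ _
  · rw [abs_of_nonneg (chainRamp_nonneg _)]
    exact chainRamp_le _

lemma contDiff_chainLink (i : ℕ) : ContDiff ℝ 2 (chainLink i) :=
  (tameDeriv_chainLink i).contDiff.of_le (by norm_num)

/-- There are only two different links, the first and all the others, so one constant serves every
index. -/
lemma exists_lipschitz_chainLink : ∃ C : ℝ, 0 ≤ C ∧ ∀ i : ℕ,
    (∀ x y, ‖fderiv ℝ (chainLink i) x - fderiv ℝ (chainLink i) y‖ ≤ C * ‖x - y‖) ∧
    ∀ x y, ‖fderiv ℝ (fderiv ℝ (chainLink i)) x - fderiv ℝ (fderiv ℝ (chainLink i)) y‖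
      ≤ C * ‖x - y‖ := by
  obtain ⟨C, hC0, hC1, hC2⟩ := (tameDeriv_chainLink 0).lipschitz_fderiv
  obtain ⟨D, hD0, hD1, hD2⟩ := (tameDeriv_chainLink 1).lipschitz_fderiv
  have hi : ∀ i : ℕ, i ≠ 0 → chainLink i = chainLink 1 := by
    intro i hi
    ext z
    simp [chainLink, chainGate, hi]
  refine ⟨max C D, hC0.trans (le_max_left _ _), fun i => ?_⟩
  by_cases h : i = 0
  · subst h
    exact ⟨fun x y => (hC1 x y).trans (by gcongr; exact le_max_left _ _),
      fun x y => (hC2 x y).trans (by gcongr; exact le_max_left _ _)⟩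
  · rw [hi i h]
    exact ⟨fun x y => (hD1 x y).trans (by gcongr; exact le_max_right _ _),
      fun x y => (hD2 x y).trans (by gcongr; exact le_max_right _ _)⟩

lemma sum_prevCoord_sq_le {T : ℕ} (v : Vec T) : ∑ i : Fin T, prevCoord i v ^ 2 ≤ ‖v‖ ^ 2 := by
  rw [EuclideanSpace.real_norm_sq_eq]
  cases T with
  | zero => simp
  | succ T =>
    rw [Fin.sum_univ_succ, Fin.sum_univ_castSucc (fun i => v i ^ 2)]
    have h0 : prevCoord (0 : Fin (T + 1)) v = 0 := by simp [prevCoord]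
    have hs : ∀ i : Fin T, prevCoord i.succ v = v i.castSucc := by
      intro i
      simp [prevCoord]
      rfl
    rw [h0]
    simp only [hs]
    nlinarith [sq_nonneg (v (Fin.last T))]

/-- Each coordinate enters at most two links: its own and the next one. -/
lemma sum_norm_link_sq_le {T : ℕ} (v : Vec T) :
    ∑ i : Fin T, ‖(prevCoord i).prod (EuclideanSpace.proj (𝕜 := ℝ) i) v‖ ^ 2 ≤ 2 * ‖v‖ ^ 2 := by
  have h1 := sum_prevCoord_sq_le v
  have h2 := EuclideanSpace.real_norm_sq_eq v
  have h : ∀ i : Fin T, ‖(prevCoord i).prod (EuclideanSpace.proj (𝕜 := ℝ) i) v‖ ^ 2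
      ≤ prevCoord i v ^ 2 + v i ^ 2 := by
    intro i
    rw [ContinuousLinearMap.prod_apply, Prod.norm_def]
    rcases max_choice ‖prevCoord i v‖ ‖EuclideanSpace.proj (𝕜 := ℝ) i v‖ with h | h
    · rw [h, Real.norm_eq_abs, sq_abs]
      nlinarith [sq_nonneg (v i)]
    · rw [h, Real.norm_eq_abs, sq_abs]
      simp only [PiLp.proj_apply]
      nlinarith [sq_nonneg (prevCoord i v)]
  calc _ ≤ ∑ i : Fin T, (prevCoord i v ^ 2 + v i ^ 2) := Finset.sum_le_sum fun i _ => h i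
    _ ≤ _ := by rw [Finset.sum_add_distrib]; linarith

lemma prevCoord_single_nonneg {T : ℕ} (i j : Fin T) :
    0 ≤ prevCoord i (EuclideanSpace.single j (1 : ℝ)) := by
  unfold prevCoord
  split_ifs
  · simp
  · simp only [PiLp.proj_apply, PiLp.single_apply]
    split_ifs <;> simp

lemma hasFDerivAt_chainLink {T : ℕ} (i : Fin T) (x : Vec T) :
    HasFDerivAt (fun x : Vec T => chainLink i ((prevCoord i).prod (EuclideanSpace.proj i) x))
      (-(chainGate i (prevCoord i x) • (chainBump (x i) • EuclideanSpace.proj (𝕜 := ℝ) i)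
          + chainRamp (x i) • (deriv (chainGate i) (prevCoord i x) • prevCoord i))
        + penaltySlope (x i) • EuclideanSpace.proj (𝕜 := ℝ) i) x := by
  have hp : HasFDerivAt (fun y : Vec T => prevCoord i y) (prevCoord i) x :=
    (prevCoord i).hasFDerivAt
  have hi : HasFDerivAt (fun y : Vec T => y i) (EuclideanSpace.proj (𝕜 := ℝ) i) x :=
    (EuclideanSpace.proj (𝕜 := ℝ) i).hasFDerivAt
  have hg : HasDerivAt (chainGate i) (deriv (chainGate i) (prevCoord i x)) (prevCoord i x) :=
    ((tameDeriv_chainGate i).contDiff.differentiable (by norm_num) _).hasDerivAt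
  exact (((hg.comp_hasFDerivAt x hp).mul
    ((hasDerivAt_chainRamp (x i)).comp_hasFDerivAt x hi)).neg).add
    ((hasDerivAt_penalty (x i)).comp_hasFDerivAt x hi)

/-- The partial derivatives of the chain function: a sum of three nonpositive terms. -/
lemma gradient_chainFun {T : ℕ} (x : Vec T) (j : Fin T) :
    ∃ r : ℝ, 0 ≤ r ∧ gradient (chainFun T) x j =
      -(chainGate j (prevCoord j x) * chainBump (x j)) - deriv chainStep (x j) * r
        + penaltySlope (x j) := by
  refine ⟨∑ i : Fin T, chainRamp (x i) * prevCoord i (EuclideanSpace.single j (1 : ℝ)),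
    Finset.sum_nonneg fun i _ => mul_nonneg (chainRamp_nonneg _) (prevCoord_single_nonneg i j), ?_⟩
  have h : HasFDerivAt (chainFun T) _ x :=
    HasFDerivAt.fun_sum (u := Finset.univ) fun i _ => hasFDerivAt_chainLink i x
  rw [gradient_apply, h.fderiv, sum_apply]
  -- The factor `prevCoord i (single j 1)` vanishes unless `j` is the predecessor of `i`, in which
  -- case the gate of `i` is a step evaluated at `x j`.
  have hterm : ∀ i : Fin T, deriv (chainGate i) (prevCoord i x)
      * prevCoord i (EuclideanSpace.single j (1 : ℝ))
      = deriv chainStep (x j) * prevCoord i (EuclideanSpace.single j (1 : ℝ)) := by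
    intro i
    by_cases h0 : (i : ℕ) = 0
    · simp [prevCoord, h0]
    · have hg : chainGate i = chainStep := by ext a; simp [chainGate, h0]
      rw [hg]
      simp only [prevCoord, h0, if_false, PiLp.proj_apply, PiLp.single_apply]
      split_ifs with hj
      · rw [hj]
      · simp
  have hsum : ∀ i : Fin T,
      (-(chainGate i (prevCoord i x) • (chainBump (x i) • EuclideanSpace.proj (𝕜 := ℝ) i)
          + chainRamp (x i) • (deriv (chainGate i) (prevCoord i x) • prevCoord i))
        + penaltySlope (x i) • EuclideanSpace.proj (𝕜 := ℝ) i : Vec T →L[ℝ] ℝ)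
          (EuclideanSpace.single j (1 : ℝ))
      = (if i = j then -(chainGate i (prevCoord i x) * chainBump (x i)) + penaltySlope (x i) else 0)
        - deriv chainStep (x j)
          * (chainRamp (x i) * prevCoord i (EuclideanSpace.single j (1 : ℝ))) := by
    intro i
    have := hterm i
    simp only [add_apply, neg_apply, smul_apply, smul_eq_mul, PiLp.proj_apply,
      PiLp.single_apply, this]
    split_ifs <;> ring
  rw [Finset.sum_congr rfl fun i _ => hsum i, Finset.sum_sub_distrib, ← Finset.mul_sum,
    Finset.sum_ite_eq' Finset.univ j]
  simp only [Finset.mem_univ, if_true]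
  ring

/-- Near `0` the step and the penalty are flat and the bump is `1`; only the gate of the
coordinate's own link remains. -/
lemma gradient_chainFun_of_abs_lt {T : ℕ} (y : Vec T) (j : Fin T) (hj : |y j| < 1 / 2) :
    gradient (chainFun T) y j = -chainGate j (prevCoord j y) := by
  obtain ⟨r, -, hr⟩ := gradient_chainFun y j
  have h := abs_lt.1 hj
  rw [hr, deriv_chainStep_of_lt h.2, penaltySlope_of_ge (by linarith),
    chainBump_eq_one (by linarith) (by linarith)]
  ring

/-- Both `n` and its predecessor lie beyond the support of `x`, so near `x` the gate of link `n`
stays closed. The statement on a neighbourhood is what also makes the Hessian row vanish. -/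
lemma gradient_chainFun_eventually_zero {T : ℕ} {x : Vec T} {s : ℕ}
    (hx : ∀ n : Fin T, s ≤ n → x n = 0) {n : Fin T} (hn : s + 1 ≤ n) :
    (fun y => gradient (chainFun T) y n) =ᶠ[nhds x] fun _ => 0 := by
  have hn0 : (n : ℕ) ≠ 0 := by omega
  set m : Fin T := ⟨n - 1, (Nat.sub_le _ _).trans_lt n.isLt⟩
  have hc : ∀ k : Fin T, x k = 0 → ∀ᶠ y : Vec T in nhds x, |y k| < 1 / 2 := by
    intro k hk
    have hcont : Continuous fun y : Vec T => |y k| := by fun_prop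
    exact hcont.continuousAt.eventually_lt continuousAt_const (by simp [hk])
  filter_upwards [hc n (hx n (by omega)), hc m (hx m (by simp only [m]; omega))] with y h1 h2
  have hp : prevCoord n y = y m := by simp [prevCoord, hn0, m]
  rw [gradient_chainFun_of_abs_lt y n h1, hp]
  simp only [chainGate, hn0, if_false]
  rw [chainStep_of_le (abs_lt.1 h2).2.le, neg_zero]

/-- At the first coordinate below `1` the gate is fully open. The three terms of that partial
derivative have the same sign, so they cannot cancel, and one of them is `-1`: the bump term on
`[-2, 1)`, the penalty slope below `-2`. -/
lemma one_le_norm_gradient_chainFun {T : ℕ} (hT : 1 ≤ T) (x : Vec T)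
    (hx : ∀ n : Fin T, T - 1 ≤ (n : ℕ) → x n = 0) : 1 ≤ ‖gradient (chainFun T) x‖ := by
  classical
  have hex : ∃ k : ℕ, ∃ h : k < T, x ⟨k, h⟩ < 1 :=
    ⟨T - 1, by omega, by rw [hx _ le_rfl]; exact one_pos⟩
  obtain ⟨hk, hxk⟩ := Nat.find_spec hex
  set j : Fin T := ⟨Nat.find hex, hk⟩ with hj
  have hgate : chainGate j (prevCoord j x) = 1 := by
    unfold chainGate
    split_ifs with h0
    · rfl
    · simp only [prevCoord, h0, if_false, PiLp.proj_apply]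
      refine chainStep_of_ge (le_of_not_gt fun hlt => ?_)
      have := Nat.find_min' hex ⟨_, hlt⟩
      simp only [hj] at h0 this
      omega
  obtain ⟨r, hr0, hr⟩ := gradient_chainFun x j
  rw [hgate, one_mul] at hr
  have h1 := mul_nonneg (deriv_chainStep_nonneg (x j)) hr0
  have h2 : gradient (chainFun T) x j ≤ -1 := by
    rw [hr]
    rcases le_total (x j) (-2) with h | h
    · rw [penaltySlope_of_le h]
      linarith [chainBump_nonneg (x j)]
    · rw [chainBump_eq_one h hxk.le]
      linarith [penaltySlope_nonpos (x j)]
  have h3 := PiLp.norm_apply_le (gradient (chainFun T) x) j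
  rw [Real.norm_eq_abs] at h3
  linarith [neg_abs_le (gradient (chainFun T) x j)]

theorem exists_zeroChain : ∃ C : ℝ, 1 ≤ C ∧ ∀ T : ℕ, 1 ≤ T →
    ZeroChain (C * T) 1 C C (chainFun T) := by
  obtain ⟨C, hC0, hC⟩ := exists_lipschitz_chainLink
  set I := ∫ t, chainBump t
  have hI : 0 ≤ I := integral_nonneg chainBump_nonneg
  -- One constant for everything: `2C` and `4C` are the Lipschitz constants of gradient and Hessian,
  -- and `I` bounds the decrease per link.
  refine ⟨1 + 4 * C + I, by linarith, fun T hT => ?_⟩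
  have hcd : ∀ i : Fin T, ContDiff ℝ 2 (chainLink i) := fun i => contDiff_chainLink i
  have hF : ContDiff ℝ 2 (chainFun T) :=
    ContDiff.sum fun i _ => (hcd i).comp (ContinuousLinearMap.contDiff _)
  refine ⟨hF, fun x => ?_, fun x y => ?_, fun x y => ?_, one_le_norm_gradient_chainFun hT,
    fun x s hx n hn => (gradient_chainFun_eventually_zero hx hn).self_of_nhds,
    fun x s hx n hn v => hessian_apply_eq_zero hF (gradient_chainFun_eventually_zero hx hn) v,
    fun x n hn => ?_, fun h1 => ?_⟩
  · have h0 : chainFun T 0 ≤ 0 := by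
      refine Finset.sum_nonpos fun i _ => ?_
      rw [map_zero]
      have := mul_nonneg (chainGate_nonneg i 0) (chainRamp_nonneg 0)
      simp only [chainLink, Prod.fst_zero, Prod.snd_zero, penalty_zero]
      linarith
    have hx : ∑ _i : Fin T, -I ≤ chainFun T x := by
      refine Finset.sum_le_sum fun i _ => ?_
      set z := (prevCoord i).prod (EuclideanSpace.proj i) x
      have h1 : chainGate i z.1 * chainRamp z.2 ≤ 1 * I :=
        mul_le_mul (chainGate_le_one _ _) (chainRamp_le _) (chainRamp_nonneg _) zero_le_one
      unfold chainLink
      linarith [penalty_nonneg z.2]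
    rw [Finset.sum_const, Finset.card_univ, Fintype.card_fin, nsmul_eq_mul] at hx
    have : (0 : ℝ) ≤ T := Nat.cast_nonneg T
    nlinarith
  · rw [norm_gradient_sub]
    refine (lipschitz_fderiv_sum_comp hcd sum_norm_link_sq_le hC0
      (fun i => (hC i).1) x y).trans ?_
    gcongr
    linarith
  · refine (norm_hessian_sub_le hF x y).trans ?_
    refine (lipschitz_fderiv_fderiv_sum_comp hcd sum_norm_link_sq_le hC0
      (fun i => (hC i).2) x y).trans ?_
    gcongr
    linarith
  · rw [gradient_chainFun_of_abs_lt x n (by rw [hn]; norm_num), abs_neg,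
      abs_of_nonneg (chainGate_nonneg _ _)]
    exact chainGate_le_one _ _
  -- The only link is the ungated first one, so the gradient is constant near `0`.
  · subst h1
    ext v n
    have h : (fun y => gradient (chainFun 1) y n) =ᶠ[nhds 0] fun _ => -1 := by
      have hcont : Continuous fun y : Vec 1 => |y n| := by fun_prop
      filter_upwards [(hcont.continuousAt (x := 0)).eventually_lt
        (continuousAt_const (y := (1 / 2 : ℝ))) (by simp)] with y hy
      rw [gradient_chainFun_of_abs_lt y n hy, chainGate, if_pos (by omega)]
    exact hessian_apply_eq_zero hF h v

/-! ### Rescaling the chain -/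

section Scaling

variable {T : ℕ} {F : Vec T → ℝ}

lemma gradient_scale (b β : ℝ) (x : Vec T) :
    gradient (fun x => b * F (β • x)) x = (b * β) • gradient F (β • x) := by
  have h : fderiv ℝ (fun x => b * F (β • x)) x = b • β • fderiv ℝ F (β • x) := by
    have h1 : fderiv ℝ (fun x => b * F (β • x)) x = b • fderiv ℝ (fun x => F (β • x)) x :=
      congrFun (fderiv_const_smul_field (𝕜 := ℝ) (f := fun x => F (β • x)) b) x
    rw [h1, fderiv_comp_smul]
  rw [gradient, gradient, h, map_smul, map_smul, smul_smul]

lemma hessian_scale (b β : ℝ) (x : Vec T) :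
    hessian (fun x => b * F (β • x)) x = (b * β * β) • hessian F (β • x) := by
  have h : gradient (fun x => b * F (β • x)) = fun x => (b * β) • gradient F (β • x) :=
    funext (gradient_scale b β)
  have h1 : fderiv ℝ (fun x => (b * β) • gradient F (β • x)) x
      = (b * β) • fderiv ℝ (fun x => gradient F (β • x)) x :=
    congrFun (fderiv_const_smul_field (𝕜 := ℝ) (f := fun x => gradient F (β • x)) (b * β)) x
  rw [hessian, hessian, h, h1, fderiv_comp_smul]
  exact smul_smul (b * β) β (fderiv ℝ (gradient F) (β • x))

/-- The parameter `a` fixes the size of the gradient and is later `2ε`; `β` remains free to trade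
smoothness against the decrease in value. -/
lemma ZeroChain.scale {D C a β : ℝ} (h : ZeroChain D 1 C C F) (ha : 0 < a) (hβ : 0 < β) :
    ZeroChain (a * β * D) a (a / β * C) (a / β ^ 2 * C) fun x => a * β * F (β⁻¹ • x) := by
  have e1 : a * β * β⁻¹ = a := by field_simp
  have hg : ∀ x, gradient (fun x => a * β * F (β⁻¹ • x)) x = a • gradient F (β⁻¹ • x) := by
    intro x
    rw [gradient_scale, e1]
  have hh : ∀ x, hessian (fun x => a * β * F (β⁻¹ • x)) x = (a / β) • hessian F (β⁻¹ • x) := by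
    intro x
    rw [hessian_scale, e1, div_eq_mul_inv]
  have hz : ∀ (x : Vec T) (n : Fin T), x n = 0 → (β⁻¹ • x) n = 0 := by
    intro x n hn
    simp [hn]
  have hn : ∀ x y : Vec T, ‖β⁻¹ • x - β⁻¹ • y‖ = β⁻¹ * ‖x - y‖ := by
    intro x y
    rw [← smul_sub, norm_smul, Real.norm_of_nonneg (by positivity)]
  refine ⟨contDiff_const.mul (h.contDiff.comp (contDiff_const_smul _)), fun x => ?_, fun x y => ?_,
    fun x y => ?_, fun x hx => ?_, fun x s hx n hn => ?_, fun x s hx n hn v => ?_, fun x n hx => ?_,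
    fun h1 => ?_⟩
  · simp only [smul_zero]
    rw [← mul_sub]
    exact mul_le_mul_of_nonneg_left (h.lower _) (by positivity)
  · rw [hg, hg, ← smul_sub, norm_smul, Real.norm_of_nonneg ha.le]
    calc a * _ ≤ a * (C * (β⁻¹ * ‖x - y‖)) := by
          rw [← hn]; exact mul_le_mul_of_nonneg_left (h.lipschitz_gradient _ _) ha.le
      _ = _ := by rw [div_eq_mul_inv]; ring
  · have e : (a / β) • hessian F (β⁻¹ • x) - (a / β) • hessian F (β⁻¹ • y)
        = (a / β) • (hessian F (β⁻¹ • x) - hessian F (β⁻¹ • y)) := (smul_sub _ _ _).symm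
    rw [hh, hh, e, norm_smul, Real.norm_of_nonneg (by positivity)]
    calc a / β * _ ≤ a / β * (C * (β⁻¹ * ‖x - y‖)) := by
          rw [← hn]; exact mul_le_mul_of_nonneg_left (h.lipschitz_hessian _ _) (by positivity)
      _ = _ := by field_simp
  · rw [hg, norm_smul, Real.norm_of_nonneg ha.le]
    exact le_mul_of_one_le_right ha.le
      (h.le_norm_gradient _ fun n hn => hz x n (hx n hn))
  · rw [hg]
    simp [h.gradient_eq_zero _ s (fun n hn => hz x n (hx n hn)) n hn]
  · rw [hh]
    simp [h.hessian_eq_zero _ s (fun n hn => hz x n (hx n hn)) n hn v]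
  · rw [hg, PiLp.smul_apply, smul_eq_mul, abs_mul, abs_of_pos ha]
    exact mul_le_of_le_one_right ha.le (h.abs_gradient_le _ n (hz x n hx))
  · rw [hh, smul_zero, h.hessian_zero h1]
    exact smul_zero (A := Mat T) (a / β)

lemma ZeroChain.smoothClass {D a ℓ₁ ℓ₂ Δ L₁ L₂ : ℝ} (h : ZeroChain D a ℓ₁ ℓ₂ F) (hD : D ≤ Δ)
    (h₁ : ℓ₁ ≤ L₁) (h₂ : ℓ₂ ≤ L₂) : SmoothClass Δ L₁ L₂ F := by
  have hle : ∀ x, F 0 - D ≤ F x := fun x => by linarith [h.lower x]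
  refine ⟨h.contDiff, ⟨F 0 - D, ?_⟩, ?_, fun x y => ?_, fun x y => ?_⟩
  · rintro _ ⟨x, rfl⟩
    exact hle x
  · linarith [le_ciInf hle]
  · exact (h.lipschitz_gradient x y).trans (by gcongr)
  · exact (h.lipschitz_hessian x y).trans (by gcongr)

lemma ZeroChain.norm_hessian_le {D a ℓ₁ ℓ₂ : ℝ} (h : ZeroChain D a ℓ₁ ℓ₂ F) (hℓ : 0 ≤ ℓ₁)
    (x : Vec T) : ‖hessian F x‖ ≤ ℓ₁ :=
  norm_fderiv_le_of_lip' ℝ hℓ (Filter.Eventually.of_forall fun y => h.lipschitz_gradient y x)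

end Scaling

/-! ### The part of an answer that is hidden -/

section Mask

variable {T : ℕ}

/-- The projection to the coordinates from which on all entries of `x` vanish. -/
def maskProj (x : Vec T) : Mat T :=
  open Classical in ∑ n : Fin T, if ∀ m, n ≤ m → x m = 0 then
    (EuclideanSpace.proj (𝕜 := ℝ) n).smulRight (EuclideanSpace.single n (1 : ℝ)) else 0

lemma maskProj_apply (x v : Vec T) (n : Fin T) [Decidable (∀ m, n ≤ m → x m = 0)] :
    maskProj x v n = if ∀ m, n ≤ m → x m = 0 then v n else 0 := by
  classical
  have h : ∀ k : Fin T, ((if ∀ m, k ≤ m → x m = 0 then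
      (EuclideanSpace.proj (𝕜 := ℝ) k).smulRight (EuclideanSpace.single k (1 : ℝ)) else 0 : Mat T) v)
        n = if n = k then (if ∀ m, n ≤ m → x m = 0 then v n else 0) else 0 := by
    intro k
    by_cases hk : n = k
    · subst hk
      by_cases hx : ∀ m, n ≤ m → x m = 0
      · rw [if_pos hx, if_pos rfl, if_pos hx]; simp
      · rw [if_neg hx, if_pos rfl, if_neg hx]; rfl
    · rw [if_neg hk]
      by_cases hx : ∀ m, k ≤ m → x m = 0
      · rw [if_pos hx]; simp [hk]
      · rw [if_neg hx]; rfl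
  rw [maskProj, sum_apply, WithLp.ofLp_sum, Finset.sum_apply, Finset.sum_congr rfl fun k _ => h k]
  simp

lemma norm_maskProj_apply_le (x v : Vec T) : ‖maskProj x v‖ ≤ ‖v‖ := by
  classical
  refine (sq_le_sq₀ (norm_nonneg _) (norm_nonneg _)).1 ?_
  rw [EuclideanSpace.real_norm_sq_eq, EuclideanSpace.real_norm_sq_eq]
  refine Finset.sum_le_sum fun n _ => ?_
  rw [maskProj_apply]
  split_ifs
  · exact le_rfl
  · simpa using sq_nonneg (v n)

lemma norm_maskProj_comp_le (x : Vec T) (H : Mat T) : ‖(maskProj x).comp H‖ ≤ ‖H‖ :=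
  ContinuousLinearMap.opNorm_le_bound _ (norm_nonneg H) fun v =>
    (norm_maskProj_apply_le x (H v)).trans (H.le_opNorm v)

lemma measurable_maskProj : Measurable (maskProj (T := T)) := by
  classical
  unfold maskProj
  refine Finset.measurable_sum _ fun n _ => Measurable.ite ?_ measurable_const measurable_const
  have : {x : Vec T | ∀ m, n ≤ m → x m = 0} = ⋂ m, ⋂ _ : n ≤ m, {x : Vec T | x m = 0} := by
    ext x; simp
  rw [this]
  exact MeasurableSet.iInter fun m => MeasurableSet.iInter fun _ =>
    measurableSet_eq_fun (by fun_prop) measurable_const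

lemma norm_le_of_support_subsingleton {v : Vec T} {a : ℝ} (ha : 0 ≤ a) (hv : ∀ n, |v n| ≤ a)
    (h : ∀ m n, v m ≠ 0 → v n ≠ 0 → m = n) : ‖v‖ ≤ a := by
  by_cases h0 : ∃ n, v n ≠ 0
  · obtain ⟨n, hn⟩ := h0
    have : v = EuclideanSpace.single n (v n) := by
      ext m
      rw [PiLp.single_apply]
      split_ifs with hm
      · rw [hm]
      · by_contra hne
        exact hm (h m n hne hn)
    rw [this, PiLp.norm_single, Real.norm_eq_abs]
    exact hv n
  · push Not at h0
    have : v = 0 := by ext n; exact h0 n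
    rw [this, norm_zero]
    exact ha

/-- The mask keeps only trailing coordinates where `x` vanishes, and the gradient vanishes beyond
the first of these. A single entry survives, so the bound depends neither on `T` nor on the
smoothness constants. -/
lemma ZeroChain.norm_maskProj_gradient_le {F : Vec T → ℝ} {D a ℓ₁ ℓ₂ : ℝ}
    (h : ZeroChain D a ℓ₁ ℓ₂ F) (ha : 0 ≤ a) (x : Vec T) : ‖maskProj x (gradient F x)‖ ≤ a := by
  classical
  refine norm_le_of_support_subsingleton ha (fun n => ?_) ?_
  · rw [maskProj_apply]
    split_ifs with hx
    · exact h.abs_gradient_le x n (hx n le_rfl)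
    · simpa using ha
  · have key : ∀ m n : Fin T, m < n → maskProj x (gradient F x) m ≠ 0 →
        maskProj x (gradient F x) n = 0 := by
      intro m n hmn hm
      rw [maskProj_apply] at hm ⊢
      have hx : ∀ k, m ≤ k → x k = 0 := by
        by_contra hx
        rw [if_neg hx] at hm
        exact hm rfl
      split_ifs
      · exact h.gradient_eq_zero x m (fun k hk => hx k hk) n hmn
      · rfl
    intro m n hm hn
    rcases lt_trichotomy m n with hlt | heq | hgt
    · exact absurd (key m n hlt hm) hn
    · exact heq
    · exact absurd (key n m hgt hn) hm

/-- In dimension one the mask is zero away from the origin, and the Hessian is zero at the origin.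
Hiding a single link thus creates no Hessian noise. -/
lemma ZeroChain.maskProj_comp_hessian_eq_zero {F : Vec T → ℝ} {D a ℓ₁ ℓ₂ : ℝ}
    (h : ZeroChain D a ℓ₁ ℓ₂ F) (hT : T = 1) (x : Vec T) : (maskProj x).comp (hessian F x) = 0 := by
  classical
  by_cases hx : x = 0
  · rw [hx, h.hessian_zero hT, ContinuousLinearMap.comp_zero]
  · ext v n
    rw [ContinuousLinearMap.comp_apply, maskProj_apply, if_neg]
    · rfl
    · intro hn
      refine hx ?_
      ext m
      exact hn m (by subst hT; exact (Subsingleton.elim n m).le)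

end Mask

/-! ### The biased coin and its moments -/

section Coin

/-- The law of a biased coin. -/
def coin (θ : ℝ) : Measure Bool :=
  ENNReal.ofReal θ • Measure.dirac true + ENNReal.ofReal (1 - θ) • Measure.dirac false

/-- The unbiased weight `1/θ` with probability `θ`, and `0` otherwise. -/
def coinWeight (θ : ℝ) (b : Bool) : ℝ := if b then 1 / θ else 0

/-- The factor in the central moments of order `p` of the coin weight. -/
def coinMoment (p θ : ℝ) : ℝ := θ * (1 / θ - 1) ^ p + (1 - θ)

variable {θ : ℝ} {W : Type*} [NormedAddCommGroup W]

lemma isProbabilityMeasure_coin (h0 : 0 ≤ θ) (h1 : θ ≤ 1) : IsProbabilityMeasure (coin θ) := by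
  constructor
  simp only [coin, Measure.add_apply, Measure.smul_apply, smul_eq_mul, measure_univ, mul_one]
  rw [← ENNReal.ofReal_add h0 (by linarith)]
  simp

lemma coin_true (θ : ℝ) : coin θ {true} = ENNReal.ofReal θ := by
  simp [coin]

lemma integrable_coin (f : Bool → W) : Integrable f (coin θ) := by
  unfold coin
  exact ((integrable_dirac (by simp)).smul_measure ENNReal.ofReal_ne_top).add_measure
    ((integrable_dirac (by simp)).smul_measure ENNReal.ofReal_ne_top)

variable [NormedSpace ℝ W]

lemma integral_coin [CompleteSpace W] (h0 : 0 ≤ θ) (h1 : θ ≤ 1) (f : Bool → W) :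
    ∫ b, f b ∂coin θ = θ • f true + (1 - θ) • f false := by
  unfold coin
  rw [integral_add_measure
    ((integrable_dirac (by simp)).smul_measure ENNReal.ofReal_ne_top)
    ((integrable_dirac (by simp)).smul_measure ENNReal.ofReal_ne_top), integral_smul_measure,
    integral_smul_measure, integral_dirac, integral_dirac, ENNReal.toReal_ofReal h0,
    ENNReal.toReal_ofReal (by linarith)]

lemma integral_coinWeight_smul [CompleteSpace W] (h0 : 0 < θ) (h1 : θ ≤ 1) (g u : W) :
    ∫ b, (g + (coinWeight θ b - 1) • u) ∂coin θ = g := by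
  rw [integral_coin h0.le h1]
  simp only [coinWeight, if_true, Bool.false_eq_true, if_false]
  rw [smul_add, smul_add, smul_smul, smul_smul, add_add_add_comm, ← add_smul, ← add_smul]
  have e1 : θ + (1 - θ) = 1 := by ring
  have e2 : θ * (1 / θ - 1) + (1 - θ) * (0 - 1) = 0 := by field_simp; ring
  rw [e1, e2, one_smul, zero_smul, add_zero]

lemma lintegral_coinWeight_smul_le (h0 : 0 < θ) (h1 : θ ≤ 1) {p a σ : ℝ} (hp : 0 ≤ p) {g u : W}
    (hu : ‖u‖ ≤ a) (h : a ^ p * coinMoment p θ ≤ σ ^ p) :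
    ∫⁻ b, ‖g + (coinWeight θ b - 1) • u - g‖ₑ ^ p ∂coin θ ≤ ENNReal.ofReal (σ ^ p) := by
  have hen : ∀ c : ℝ, ‖g + c • u - g‖ₑ ^ p = ENNReal.ofReal ((|c| * ‖u‖) ^ p) := by
    intro c
    rw [add_sub_cancel_left, ← ofReal_norm, norm_smul, Real.norm_eq_abs,
      ENNReal.ofReal_rpow_of_nonneg (by positivity) hp]
  have hinv : 0 ≤ 1 / θ - 1 := by
    rw [sub_nonneg, le_div_iff₀ h0]; linarith
  unfold coin
  rw [lintegral_add_measure, lintegral_smul_measure, lintegral_smul_measure, lintegral_dirac,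
    lintegral_dirac, hen, hen, smul_eq_mul, smul_eq_mul, ← ENNReal.ofReal_mul h0.le,
    ← ENNReal.ofReal_mul (by linarith), ← ENNReal.ofReal_add (by positivity)
      (mul_nonneg (by linarith) (by positivity))]
  refine ENNReal.ofReal_le_ofReal (le_trans ?_ h)
  have hle : ‖u‖ ^ p ≤ a ^ p := Real.rpow_le_rpow (norm_nonneg _) hu hp
  simp only [coinWeight, if_true, Bool.false_eq_true, if_false, zero_sub, abs_neg, abs_one, one_mul]
  rw [abs_of_nonneg hinv, Real.mul_rpow hinv (norm_nonneg _)]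
  have hm : 0 ≤ coinMoment p θ := add_nonneg (by positivity) (by linarith)
  calc _ = ‖u‖ ^ p * coinMoment p θ := by unfold coinMoment; ring
    _ ≤ _ := mul_le_mul_of_nonneg_right hle hm

end Coin

/-! ### The hiding oracle -/

section Oracle

variable {T : ℕ} {F : Vec T → ℝ} {θ : ℝ}

/-- The oracle that reveals undiscovered coordinates only with probability `θ`. -/
def hidingOracle (hF : ContDiff ℝ 2 F) (h0 : 0 < θ) (h1 : θ ≤ 1) : StochOracle F where
  Z := Bool
  measZ := inferInstance
  P := coin θ
  isProb := isProbabilityMeasure_coin h0.le h1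
  grad x b := gradient F x + (coinWeight θ b - 1) • maskProj x (gradient F x)
  hess x b := hessian F x + (coinWeight θ b - 1) • (maskProj x).comp (hessian F x)
  measurable_grad := by
    have hg : Measurable (gradient F) := (contDiff_gradient hF).continuous.measurable
    have hm : Measurable fun x => maskProj x (gradient F x) :=
      (isBoundedBilinearMap_apply (𝕜 := ℝ) (E := Vec T) (F := Vec T)).continuous.measurable.comp
        (measurable_maskProj.prodMk hg)
    have hw : Measurable fun b => coinWeight θ b - 1 := measurable_from_top
    exact (hg.comp measurable_fst).add ((hw.comp measurable_snd).smul (hm.comp measurable_fst))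
  measurable_hess := by
    have hg : Measurable (hessian F) :=
      ((contDiff_gradient hF).continuous_fderiv (by norm_num)).measurable
    have hm : Measurable fun x => (maskProj x).comp (hessian F x) :=
      (isBoundedBilinearMap_comp (𝕜 := ℝ) (E := Vec T) (F := Vec T)
        (G := Vec T)).continuous.measurable.comp (measurable_maskProj.prodMk hg)
    have hw : Measurable fun b => coinWeight θ b - 1 := measurable_from_top
    exact (hg.comp measurable_fst).add ((hw.comp measurable_snd).smul (hm.comp measurable_fst))
  integrable_grad _ := integrable_coin _
  integrable_hess _ := integrable_coin _
  unbiased_grad _ := integral_coinWeight_smul h0 h1 _ _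
  unbiased_hess _ := integral_coinWeight_smul h0 h1 _ _

/-- The lower bound for a chain with a hiding oracle. -/
theorem ZeroChain.exists_oracle {D ε ℓ₁ ℓ₂ p q σ₁ σ₂ : ℝ} (hF : ZeroChain D (2 * ε) ℓ₁ ℓ₂ F)
    (hT : 1 ≤ T) (hε : 0 < ε) (hℓ : 0 ≤ ℓ₁) (h0 : 0 < θ) (h1 : θ ≤ 1) (hp : 1 < p) (hq : 1 ≤ q)
    (hσ₂0 : 0 ≤ σ₂) (hσ₁ : (2 * ε) ^ p * coinMoment p θ ≤ σ₁ ^ p)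
    (hσ₂ : T = 1 ∨ ℓ₁ ^ q * coinMoment q θ ≤ σ₂ ^ q) :
    ∃ O : StochOracle F, O.GradBCM p σ₁ ∧ O.HessBCM q σ₂ ∧
      ∀ (K : ℕ) (A : BatchAlgorithm.{u} T K), A.ZeroRespecting →
        ENNReal.ofReal (T / (2 * θ)) ≤ A.rounds O ε := by
  classical
  refine ⟨hidingOracle hF.contDiff h0 h1, fun x => ?_, fun x => ?_, fun K A hA => ?_⟩
  · exact lintegral_coinWeight_smul_le h0 h1 (by linarith)
      (hF.norm_maskProj_gradient_le (by positivity) x) hσ₁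
  · rcases hσ₂ with hT1 | hσ₂
    · refine lintegral_coinWeight_smul_le h0 h1 (a := 0) (by linarith) ?_ ?_
      · rw [hF.maskProj_comp_hessian_eq_zero hT1, norm_zero]
      · rw [Real.zero_rpow (by linarith), zero_mul]
        positivity
    · exact lintegral_coinWeight_smul_le h0 h1 (by linarith)
        ((norm_maskProj_comp_le x _).trans (hF.norm_hessian_le hℓ x)) hσ₂
  -- From coordinate `s` on the mask is the identity, so the estimate is the true entry times the
  -- coin weight: tails hides it, heads reveals at most coordinate `s`. With `hessian F x v` in
  -- place of `v` this covers the rows of the Hessian.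
  · have hmask : ∀ (x v : Vec T) (b : Bool) (s : ℕ), (∀ n : Fin T, s ≤ n → x n = 0) →
        ∀ n : Fin T, s ≤ n →
          (v + (coinWeight θ b - 1) • maskProj x v) n = coinWeight θ b * v n := by
      intro x v b s hx n hn
      rw [PiLp.add_apply, PiLp.smul_apply, maskProj_apply,
        if_pos fun m hm => hx m (hn.trans (Fin.le_def.1 hm)), smul_eq_mul]
      ring
    refine rounds_ge_of_progress hT hF.contDiff (hidingOracle hF.contDiff h0 h1)
      (B := ({true} : Set Bool)) (MeasurableSet.singleton true) h0 hε (coin_true θ).le ?_ ?_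
      hF.le_norm_gradient A hA
    · rintro x ξ s hx hξ n hn
      have hw : coinWeight θ ξ = 0 := by
        have : ξ = false := Bool.eq_false_of_not_eq_true hξ
        simp [coinWeight, this]
      by_contra hns
      rw [not_lt] at hns
      rcases hn with hn | ⟨v, hn⟩
      · exact hn ((hmask x (gradient F x) ξ s hx n hns).trans (by rw [hw, zero_mul]))
      · exact hn ((hmask x (hessian F x v) ξ s hx n hns).trans (by rw [hw, zero_mul]))
    · rintro x ξ s hx n hn
      by_contra hns
      rw [not_lt] at hns
      have hns' : s ≤ (n : ℕ) := by omega
      rcases hn with hn | ⟨v, hn⟩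
      · exact hn ((hmask x (gradient F x) ξ s hx n hns').trans
          (by rw [hF.gradient_eq_zero x s hx n hns, mul_zero]))
      · exact hn ((hmask x (hessian F x v) ξ s hx n hns').trans
          (by rw [hF.hessian_eq_zero x s hx n hns v, mul_zero]))

end Oracle

/-! ### Noise calibration and hard instances -/

lemma coinMoment_one {p : ℝ} (hp : 0 < p) : coinMoment p 1 = 0 := by
  simp [coinMoment, Real.zero_rpow hp.ne']

/-- The coin moment is at most `2 θ^(1-p)`, and the factor `2` is absorbed by `2 ≤ 2^p`. -/
lemma rpow_mul_coinMoment_le {p θ a σ : ℝ} (hp : 1 ≤ p) (h0 : 0 < θ) (h1 : θ ≤ 1) (ha : 0 ≤ a)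
    (h : 2 * a * θ ^ ((1 - p) / p) ≤ σ) : a ^ p * coinMoment p θ ≤ σ ^ p := by
  have hp0 : 0 < p := by linarith
  have hinv : 0 ≤ 1 / θ - 1 := by
    rw [sub_nonneg, le_div_iff₀ h0]; linarith
  have hθp : (θ ^ ((1 - p) / p)) ^ p = θ ^ (1 - p) := by
    rw [← Real.rpow_mul h0.le, div_mul_cancel₀ _ hp0.ne']
  have hm : coinMoment p θ ≤ 2 * θ ^ (1 - p) := by
    have e1 : θ * (1 / θ - 1) ^ p ≤ θ ^ (1 - p) := by
      have : (1 / θ - 1) ^ p ≤ θ ^ (-p) := by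
        rw [Real.rpow_neg h0.le, ← Real.inv_rpow h0.le, ← one_div]
        exact Real.rpow_le_rpow hinv (by linarith) hp0.le
      calc _ ≤ θ * θ ^ (-p) := mul_le_mul_of_nonneg_left this h0.le
        _ = θ ^ (1 - p) := by rw [sub_eq_add_neg, Real.rpow_add h0, Real.rpow_one]
    have e2 : 1 ≤ θ ^ (1 - p) :=
      Real.one_le_rpow_of_pos_of_le_one_of_nonpos h0 h1 (by linarith)
    unfold coinMoment
    linarith
  have h2 : (2 : ℝ) ≤ 2 ^ p := by
    calc (2 : ℝ) = 2 ^ (1 : ℝ) := (Real.rpow_one 2).symm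
      _ ≤ 2 ^ p := Real.rpow_le_rpow_of_exponent_le (by norm_num) hp
  calc a ^ p * coinMoment p θ ≤ a ^ p * (2 * θ ^ (1 - p)) :=
        mul_le_mul_of_nonneg_left hm (by positivity)
    _ ≤ a ^ p * (2 ^ p * θ ^ (1 - p)) := by gcongr
    _ = (2 * a * θ ^ ((1 - p) / p)) ^ p := by
        rw [Real.mul_rpow (by positivity) (by positivity), Real.mul_rpow (by norm_num) ha, hθp]
        ring
    _ ≤ σ ^ p := Real.rpow_le_rpow (by positivity) h hp0.le

/-- There is an admissible instance on which every zero-respecting algorithm needs at least `r`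
rounds. -/
def HasHardInstance (ε Δ L₁ L₂ p q σ₁ σ₂ r : ℝ) : Prop :=
  ∃ (d : ℕ) (F : Vec d → ℝ) (O : StochOracle F), 1 ≤ d ∧ SmoothClass Δ L₁ L₂ F ∧
    O.GradBCM p σ₁ ∧ O.HessBCM q σ₂ ∧ ∀ (K : ℕ) (A : BatchAlgorithm.{u} d K), A.ZeroRespecting →
      ENNReal.ofReal r ≤ A.rounds O ε

lemma HasHardInstance.mono {ε Δ L₁ L₂ p q σ₁ σ₂ r r' : ℝ}
    (h : HasHardInstance.{u} ε Δ L₁ L₂ p q σ₁ σ₂ r) (hr : r' ≤ r) :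
    HasHardInstance.{u} ε Δ L₁ L₂ p q σ₁ σ₂ r' := by
  obtain ⟨d, F, O, hd, hF, hg, hh, hA⟩ := h
  exact ⟨d, F, O, hd, hF, hg, hh, fun K A hz => (ENNReal.ofReal_le_ofReal hr).trans (hA K A hz)⟩

section Instances

variable {C ε Δ L₁ L₂ p q σ₁ σ₂ θ β : ℝ}

lemma hasHardInstance_of_length {T : ℕ} (hC : 1 ≤ C) (hT : 1 ≤ T)
    (hchain : ZeroChain (C * T) 1 C C (chainFun T)) (hε : 0 < ε) (hβ : 0 < β) (h0 : 0 < θ)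
    (h1 : θ ≤ 1) (hp : 1 < p) (hq : 1 ≤ q) (hσ₂0 : 0 ≤ σ₂) (hΔ : 2 * ε * β * (C * T) ≤ Δ)
    (hL₁ : 2 * ε / β * C ≤ L₁) (hL₂ : 2 * ε / β ^ 2 * C ≤ L₂)
    (hσ₁ : (2 * ε) ^ p * coinMoment p θ ≤ σ₁ ^ p)
    (hσ₂ : T = 1 ∨ (2 * ε / β * C) ^ q * coinMoment q θ ≤ σ₂ ^ q) :
    HasHardInstance.{u} ε Δ L₁ L₂ p q σ₁ σ₂ (T / (2 * θ)) := by
  have hs := hchain.scale (a := 2 * ε) (by positivity) hβ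
  obtain ⟨O, hg, hh, hA⟩ := hs.exists_oracle hT hε (by positivity) h0 h1 hp hq hσ₂0 hσ₁ hσ₂
  exact ⟨T, _, O, hT, hs.smoothClass hΔ hL₁ hL₂, hg, hh, hA⟩

/-- The longest chain that the budget `Δ` allows. At least one link fits, so rounding down loses at
most a factor `2`. -/
lemma hasHardInstance_long (hC : 1 ≤ C)
    (hchain : ∀ T : ℕ, 1 ≤ T → ZeroChain (C * T) 1 C C (chainFun T)) (hε : 0 < ε) (hβ : 0 < β)
    (h0 : 0 < θ) (h1 : θ ≤ 1) (hp : 1 < p) (hq : 1 ≤ q) (hσ₂0 : 0 ≤ σ₂)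
    (hΔ : 2 * ε * β * C ≤ Δ) (hL₁ : 2 * ε / β * C ≤ L₁) (hL₂ : 2 * ε / β ^ 2 * C ≤ L₂)
    (hσ₁ : (2 * ε) ^ p * coinMoment p θ ≤ σ₁ ^ p)
    (hσ₂ : (2 * ε / β * C) ^ q * coinMoment q θ ≤ σ₂ ^ q) :
    HasHardInstance.{u} ε Δ L₁ L₂ p q σ₁ σ₂ (Δ / (8 * ε * β * C * θ)) := by
  have hden : 0 < 2 * ε * β * C := by positivity
  set y := Δ / (2 * ε * β * C) with hy
  have hy1 : 1 ≤ y := (one_le_div hden).2 hΔ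
  have hT : 1 ≤ ⌊y⌋₊ := Nat.one_le_floor_iff y |>.2 hy1
  have hfl : (⌊y⌋₊ : ℝ) ≤ y := Nat.floor_le (by linarith)
  have hlt : y < ⌊y⌋₊ + 1 := Nat.lt_floor_add_one y
  have hT' : (1 : ℝ) ≤ ⌊y⌋₊ := by exact_mod_cast hT
  refine (hasHardInstance_of_length hC hT (hchain _ hT) hε hβ h0 h1 hp hq hσ₂0 ?_ hL₁ hL₂ hσ₁
    (Or.inr hσ₂)).mono ?_
  · rw [hy, le_div_iff₀ hden] at hfl
    linarith
  · have e : Δ / (8 * ε * β * C * θ) = (y / 2) / (2 * θ) := by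
      rw [hy]; field_simp; norm_num
    rw [e]
    gcongr
    linarith

/-- A single link stretched until it uses all of `Δ`. It has no Hessian noise, so `θ` is limited by
`σ₁` alone; this yields the summand `(σ₁/ε)^(p/(p-1))`. -/
lemma hasHardInstance_short (hC : 1 ≤ C)
    (hchain : ∀ T : ℕ, 1 ≤ T → ZeroChain (C * T) 1 C C (chainFun T)) (hε : 0 < ε) (hΔ : 0 < Δ)
    (h0 : 0 < θ) (h1 : θ ≤ 1) (hp : 1 < p) (hq : 1 ≤ q) (hσ₂0 : 0 ≤ σ₂)
    (hL₁ : 4 * C ^ 2 * ε ^ 2 ≤ L₁ * Δ) (hL₂ : 8 * C ^ 3 * ε ^ 3 ≤ L₂ * Δ ^ 2)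
    (hσ₁ : (2 * ε) ^ p * coinMoment p θ ≤ σ₁ ^ p) :
    HasHardInstance.{u} ε Δ L₁ L₂ p q σ₁ σ₂ (1 / (2 * θ)) := by
  have hC0 : 0 < C := by linarith
  have h := hasHardInstance_of_length.{u} (L₁ := L₁) (L₂ := L₂) (β := Δ / (2 * ε * C)) hC le_rfl
    (hchain 1 le_rfl) hε (by positivity) h0 h1 hp hq hσ₂0 (Δ := Δ)
    (by rw [Nat.cast_one]; apply le_of_eq; field_simp) ?_ ?_ hσ₁ (Or.inl rfl)
  · simpa using h
  · have e : 2 * ε / (Δ / (2 * ε * C)) * C = 4 * C ^ 2 * ε ^ 2 / Δ := by field_simp; norm_num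
    rw [e, div_le_iff₀ hΔ]
    exact hL₁
  · have e : 2 * ε / (Δ / (2 * ε * C)) ^ 2 * C = 8 * C ^ 3 * ε ^ 3 / Δ ^ 2 := by
      field_simp; norm_num
    rw [e, div_le_iff₀ (by positivity)]
    exact hL₂

end Instances

/-! ### From instances to the rate -/

section Rates

variable {C ε Δ L₁ L₂ p q σ₁ σ₂ : ℝ}

/-- The scales on which the chain satisfies both smoothness constraints. -/
lemma smoothness_of_scale_ge (hC : 1 ≤ C) (hε : 0 < ε) (hL₁ : 0 < L₁) (hL₂ : 0 < L₂) {β : ℝ}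
    (h₁ : 2 * ε * C / L₁ ≤ β) (h₂ : 2 * C * √ε / √L₂ ≤ β) :
    0 < β ∧ 2 * ε / β * C ≤ L₁ ∧ 2 * ε / β ^ 2 * C ≤ L₂ := by
  have hC0 : 0 < C := by linarith
  have hβ : 0 < β := lt_of_lt_of_le (by positivity) h₁
  refine ⟨hβ, ?_, ?_⟩
  · rw [div_le_iff₀ hL₁] at h₁
    rw [div_mul_eq_mul_div, div_le_iff₀ hβ]
    linarith
  · have hs : (2 * C * √ε / √L₂) ^ 2 ≤ β ^ 2 := pow_le_pow_left₀ (by positivity) h₂ 2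
    rw [div_pow, mul_pow, Real.sq_sqrt hε.le, Real.sq_sqrt hL₂.le, div_le_iff₀ hL₂] at hs
    rw [div_mul_eq_mul_div, div_le_iff₀ (by positivity)]
    have : 2 * ε * C ≤ (2 * C) ^ 2 * ε := by
      have : 0 ≤ ε * C * (4 * C - 2) := mul_nonneg (by positivity) (by linarith)
      nlinarith
    linarith

/-- With `θ = 1` there is no noise, and `β` is the smallest scale compatible with both smoothness
constants. The last two hypotheses say that one link of that scale fits into `Δ`. -/
lemma hasHardInstance_deterministic (hC : 1 ≤ C)
    (hchain : ∀ T : ℕ, 1 ≤ T → ZeroChain (C * T) 1 C C (chainFun T)) (hε : 0 < ε) (hΔ : 0 < Δ)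
    (hL₁ : 0 < L₁) (hL₂ : 0 < L₂) (hp : 1 < p) (hq : 1 ≤ q) (hσ₁ : 0 ≤ σ₁) (hσ₂ : 0 ≤ σ₂)
    (hA : 4 * C ^ 2 * ε ^ 2 ≤ L₁ * Δ) (hB : 4 * C ^ 2 * (ε * √ε) ≤ √L₂ * Δ) :
    HasHardInstance.{u} ε Δ L₁ L₂ p q σ₁ σ₂
      (min (L₁ * Δ / ε ^ 2) (√L₂ * Δ / (ε * √ε)) / (16 * C ^ 2)) := by
  have hC0 : 0 < C := by linarith
  have hw : 0 < √ε := Real.sqrt_pos.2 hε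
  have hv : 0 < √L₂ := Real.sqrt_pos.2 hL₂
  set β := max (2 * ε * C / L₁) (2 * C * √ε / √L₂) with hβdef
  obtain ⟨hβ, h1, h2⟩ := smoothness_of_scale_ge hC hε hL₁ hL₂ (le_max_left _ _) (le_max_right _ _)
  have hΔβ : 2 * ε * β * C ≤ Δ := by
    rcases max_choice (2 * ε * C / L₁) (2 * C * √ε / √L₂) with h | h
    · rw [hβdef, h]
      have : 2 * ε * (2 * ε * C / L₁) * C = 4 * C ^ 2 * ε ^ 2 / L₁ := by field_simp; norm_num
      rw [this, div_le_iff₀ hL₁]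
      linarith
    · rw [hβdef, h]
      have : 2 * ε * (2 * C * √ε / √L₂) * C = 4 * C ^ 2 * (ε * √ε) / √L₂ := by
        field_simp; norm_num
      rw [this, div_le_iff₀ hv]
      linarith
  refine (hasHardInstance_long hC hchain hε hβ one_pos le_rfl hp hq hσ₂ hΔβ h1 h2 ?_ ?_).mono ?_
  · rw [coinMoment_one (by linarith), mul_zero]; positivity
  · rw [coinMoment_one (by linarith), mul_zero]; positivity
  · rcases max_choice (2 * ε * C / L₁) (2 * C * √ε / √L₂) with h | h
    · rw [h]
      refine (div_le_div_of_nonneg_right (min_le_left _ _) (by positivity)).trans (le_of_eq ?_)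
      field_simp; norm_num
    · rw [h]
      refine (div_le_div_of_nonneg_right (min_le_right _ _) (by positivity)).trans (le_of_eq ?_)
      field_simp; norm_num

/-- A third threshold for `β` keeps the Hessian noise, amplified by `D`, below `σ₂`; `hS` says that
one link at this threshold fits into `Δ`. The binding threshold decides which of the three rates is
attained. -/
lemma hasHardInstance_noisy (hC : 1 ≤ C)
    (hchain : ∀ T : ℕ, 1 ≤ T → ZeroChain (C * T) 1 C C (chainFun T)) (hε : 0 < ε) (hΔ : 0 < Δ)
    (hL₁ : 0 < L₁) (hL₂ : 0 < L₂) (hp : 1 < p) (hq : 1 ≤ q) (hσ₂ : 0 < σ₂)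
    (hA : 4 * C ^ 2 * ε ^ 2 ≤ L₁ * Δ) (hB : 4 * C ^ 2 * (ε * √ε) ≤ √L₂ * Δ) {θ D : ℝ} (h0 : 0 < θ)
    (h1 : θ ≤ 1) (hD : D = θ ^ ((1 - q) / q)) (hS : 8 * C ^ 2 * D ≤ σ₂ * Δ / ε ^ 2)
    (hσ₁ : (2 * ε) ^ p * coinMoment p θ ≤ σ₁ ^ p) :
    HasHardInstance.{u} ε Δ L₁ L₂ p q σ₁ σ₂
      (min (min (L₁ * Δ / ε ^ 2 / θ) (√L₂ * Δ / (ε * √ε) / θ)) (σ₂ * Δ / ε ^ 2 / (D * θ))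
        / (32 * C ^ 2)) := by
  have hC0 : 0 < C := by linarith
  have hw : 0 < √ε := Real.sqrt_pos.2 hε
  have hv : 0 < √L₂ := Real.sqrt_pos.2 hL₂
  have hD0 : 0 < D := hD ▸ Real.rpow_pos_of_pos h0 _
  obtain ⟨β, hβ1, hβ2, hβ3, hβ⟩ : ∃ β, 2 * ε * C / L₁ ≤ β ∧ 2 * C * √ε / √L₂ ≤ β ∧
      4 * ε * C * D / σ₂ ≤ β ∧
      (β = 2 * ε * C / L₁ ∨ β = 2 * C * √ε / √L₂ ∨ β = 4 * ε * C * D / σ₂) := by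
    refine ⟨max (2 * ε * C / L₁) (max (2 * C * √ε / √L₂) (4 * ε * C * D / σ₂)), le_max_left _ _,
      (le_max_left _ _).trans (le_max_right _ _), (le_max_right _ _).trans (le_max_right _ _), ?_⟩
    rcases max_choice (2 * ε * C / L₁) (max (2 * C * √ε / √L₂) (4 * ε * C * D / σ₂)) with h | h
    · exact Or.inl h
    · rw [h]
      exact Or.inr (max_choice _ _)
  obtain ⟨hβ0, hl1, hl2⟩ := smoothness_of_scale_ge hC hε hL₁ hL₂ hβ1 hβ2
  have hΔβ : 2 * ε * β * C ≤ Δ := by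
    rcases hβ with h | h | h
    · have : 2 * ε * β * C = 4 * C ^ 2 * ε ^ 2 / L₁ := by rw [h]; field_simp; norm_num
      rw [this, div_le_iff₀ hL₁]
      linarith
    · have : 2 * ε * β * C = 4 * C ^ 2 * (ε * √ε) / √L₂ := by rw [h]; field_simp; norm_num
      rw [this, div_le_iff₀ hv]
      linarith
    · have : 2 * ε * β * C = 8 * C ^ 2 * D * ε ^ 2 / σ₂ := by rw [h]; field_simp; norm_num
      rw [this, div_le_iff₀ hσ₂]
      rw [le_div_iff₀ (by positivity)] at hS
      linarith
  have hmom : (2 * ε / β * C) ^ q * coinMoment q θ ≤ σ₂ ^ q := by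
    refine rpow_mul_coinMoment_le hq h0 h1 (by positivity) ?_
    rw [← hD]
    rw [div_le_iff₀ hσ₂] at hβ3
    have : 2 * (2 * ε / β * C) * D = 4 * ε * C * D / β := by ring
    rw [this, div_le_iff₀ hβ0]
    linarith
  refine (hasHardInstance_long hC hchain hε hβ0 h0 h1 hp hq hσ₂.le hΔβ hl1 hl2 hσ₁ hmom).mono ?_
  set R₁ := L₁ * Δ / ε ^ 2 / θ with hR₁
  set R₂ := √L₂ * Δ / (ε * √ε) / θ with hR₂
  set R₃ := σ₂ * Δ / ε ^ 2 / (D * θ) with hR₃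
  have hR₁0 : 0 ≤ R₁ := by positivity
  have hR₂0 : 0 ≤ R₂ := by positivity
  rcases hβ with h | h | h
  · have e : Δ / (8 * ε * β * C * θ) = R₁ / (16 * C ^ 2) := by
      rw [h, hR₁]; field_simp; norm_num
    rw [e]
    exact div_le_div₀ hR₁0 ((min_le_left _ _).trans (min_le_left _ _)) (by positivity)
      (by nlinarith [sq_nonneg C])
  · have e : Δ / (8 * ε * β * C * θ) = R₂ / (16 * C ^ 2) := by
      rw [h, hR₂]; field_simp; norm_num
    rw [e]
    exact div_le_div₀ hR₂0 ((min_le_left _ _).trans (min_le_right _ _)) (by positivity)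
      (by nlinarith [sq_nonneg C])
  · have e : Δ / (8 * ε * β * C * θ) = R₃ / (32 * C ^ 2) := by
      rw [h, hR₃]; field_simp; norm_num
    rw [e]
    exact div_le_div_of_nonneg_right (min_le_right _ _) (by positivity)

/-- The combinatorial part of the estimate of the rate. -/
lemma min_rate_le {R₁ R₂ S N n : ℝ} (hR₁ : 0 ≤ R₁) (hR₂ : 0 ≤ R₂) (hS : 0 ≤ S) (hN : 1 ≤ N)
    (hn : 1 ≤ n) :
    min (min (R₁ + R₁ * N) (R₂ + R₂ * N)) (min R₁ R₂ + S + S * n + N)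
      ≤ min R₁ R₂ + 2 * min (min (R₁ * N) (R₂ * N)) (S * n) + N := by
  have hA : 0 ≤ min R₁ R₂ := le_min hR₁ hR₂
  rcases min_choice (min (R₁ * N) (R₂ * N)) (S * n) with h | h
  · rcases min_choice (R₁ * N) (R₂ * N) with h' | h'
    · refine ((min_le_left _ _).trans (min_le_left _ _)).trans ?_
      rw [h, h']
      nlinarith
    · refine ((min_le_left _ _).trans (min_le_right _ _)).trans ?_
      rw [h, h']
      nlinarith
  · refine (min_le_right _ _).trans ?_
    rw [h]
    nlinarith

/-- For `σ₁ < 4ε` the factor `N` is bounded, and the chain without noise suffices. Otherwise the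
probability `θ` is chosen as small as `rpow_mul_coinMoment_le` permits for the gradient noise, and
the instances are compared. -/
theorem hasHardInstance_lowerBoundRate (hC : 1 ≤ C)
    (hchain : ∀ T : ℕ, 1 ≤ T → ZeroChain (C * T) 1 C C (chainFun T)) (hε : 0 < ε) (hΔ : 0 < Δ)
    (hL₁ : 0 < L₁) (hL₂ : 0 < L₂) (hp : 1 < p) (hq : 1 ≤ q) (hσ₁ : 0 ≤ σ₁) (hσ₂ : 0 ≤ σ₂)
    (hA : 4 * C ^ 2 * ε ^ 2 ≤ L₁ * Δ) (hB : 4 * C ^ 2 * (ε * √ε) ≤ √L₂ * Δ) :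
    HasHardInstance.{u} ε Δ L₁ L₂ p q σ₁ σ₂
      (1 / (100 * C ^ 2 * 4 ^ (p / (p - 1))) * lowerBoundRate ε Δ L₁ L₂ p q σ₁ σ₂) := by
  have hC0 : 0 < C := by linarith
  have hp1 : 0 < p - 1 := by linarith
  have hw : 0 < √ε := Real.sqrt_pos.2 hε
  set k := p / (p - 1) with hk
  have hk0 : 0 < k := by positivity
  set M : ℝ := 4 ^ k with hM
  have hM1 : 1 ≤ M := Real.one_le_rpow (by norm_num) hk0.le
  set N := (σ₁ / ε) ^ k with hN
  set R₁ := L₁ * Δ / ε ^ 2 with hR₁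
  set R₂ := √L₂ * Δ / (ε * √ε) with hR₂
  set S := σ₂ * Δ / ε ^ 2 with hS
  set n := N ^ (1 / q) with hn
  have hR₁0 : 0 ≤ R₁ := by positivity
  have hR₂0 : 0 ≤ R₂ := by positivity
  have hS0 : 0 ≤ S := by positivity
  have hN0 : 0 ≤ N := by positivity
  have hrate : lowerBoundRate ε Δ L₁ L₂ p q σ₁ σ₂ =
      min (min (R₁ + R₁ * N) (R₂ + R₂ * N)) (min R₁ R₂ + S + S * n + N) := by
    have e1 : ε ^ (3 / 2 : ℝ) = ε * √ε := by
      rw [Real.sqrt_eq_rpow, show (3 / 2 : ℝ) = 1 + 1 / 2 by norm_num, Real.rpow_add hε,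
        Real.rpow_one]
    have e2 : (σ₁ / ε) ^ (p / (q * (p - 1))) = n := by
      rw [hn, hN, ← Real.rpow_mul (by positivity)]
      congr 1
      rw [hk]
      field_simp
    rw [lowerBoundRate, e1, e2, ← Real.sqrt_eq_rpow]
  rw [hrate]
  have hdet := hasHardInstance_deterministic.{u} (σ₁ := σ₁) (σ₂ := σ₂) hC hchain hε hΔ hL₁ hL₂
    hp hq hσ₁ hσ₂ hA hB
  have hAm : 0 ≤ min R₁ R₂ := le_min hR₁0 hR₂0
  rcases lt_or_ge σ₁ (4 * ε) with hsmall | hlarge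
  · refine hdet.mono ?_
    have hNM : N ≤ M :=
      Real.rpow_le_rpow (by positivity) ((div_le_iff₀ hε).2 hsmall.le) hk0.le
    have hle : min (min (R₁ + R₁ * N) (R₂ + R₂ * N)) (min R₁ R₂ + S + S * n + N)
        ≤ 2 * M * min R₁ R₂ := by
      refine (min_le_left _ _).trans ?_
      rcases min_choice R₁ R₂ with h | h
      · refine (min_le_left _ _).trans ?_
        rw [h]
        nlinarith
      · refine (min_le_right _ _).trans ?_
        rw [h]
        nlinarith
    calc _ ≤ 1 / (100 * C ^ 2 * M) * (2 * M * min R₁ R₂) := by gcongr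
      _ = min R₁ R₂ / (50 * C ^ 2) := by field_simp; ring
      _ ≤ min R₁ R₂ / (16 * C ^ 2) := by gcongr; norm_num
  · have hσ₁0 : 0 < σ₁ := lt_of_lt_of_le (by positivity) hlarge
    have hMN : M ≤ N :=
      Real.rpow_le_rpow (by norm_num) ((le_div_iff₀ hε).2 hlarge) hk0.le
    have hNpos : 0 < N := by linarith
    have hN1 : 1 ≤ N := hM1.trans hMN
    have hn1 : 1 ≤ n := Real.one_le_rpow hN1 (by positivity)
    -- Equals `(4ε/σ₁)^(p/(p-1))`, for which the moment condition `2 (2ε) θ^((1-p)/p) ≤ σ₁` is an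
    -- equality.
    set θ := M / N with hθ
    have hθ0 : 0 < θ := by positivity
    have hθ1 : θ ≤ 1 := (div_le_one hNpos).2 hMN
    have hgrad : (2 * ε) ^ p * coinMoment p θ ≤ σ₁ ^ p := by
      refine rpow_mul_coinMoment_le hp.le hθ0 hθ1 (by positivity) (le_of_eq ?_)
      have e : θ ^ ((1 - p) / p) = σ₁ / (4 * ε) := by
        rw [hθ, hM, hN, ← Real.div_rpow (by norm_num) (by positivity),
          ← Real.rpow_mul (by positivity)]
        have : k * ((1 - p) / p) = -1 := by
          rw [hk]; field_simp; ring
        rw [this, Real.rpow_neg_one]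
        field_simp
      rw [e]
      field_simp
      norm_num
    have hshort := hasHardInstance_short.{u} (L₁ := L₁) (L₂ := L₂) hC hchain hε hΔ hθ0 hθ1 hp hq
      hσ₂ hA (by
        have h := pow_le_pow_left₀ (by positivity) hB 2
        rw [mul_pow, mul_pow √L₂, mul_pow ε, Real.sq_sqrt hε.le, Real.sq_sqrt hL₂.le] at h
        refine le_trans ?_ h
        have : 8 * C ^ 3 * ε ^ 3 ≤ 16 * C ^ 4 * ε ^ 3 := by
          gcongr ?_ * _
          nlinarith [pow_pos hC0 3]
        linarith) hgrad
    have hshort' : 1 / (2 * θ) = N / (2 * M) := by rw [hθ]; field_simp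
    rw [hshort'] at hshort
    set D := θ ^ ((1 - q) / q) with hD
    have hD0 : 0 < D := Real.rpow_pos_of_pos hθ0 _
    have hq0 : 0 < q := by linarith
    -- For the case in which the noisy chain does not fit into `Δ`: its contribution `S * n` is then
    -- below a multiple of `D * n`, hence of `N`.
    have hDn : D * n ≤ N := by
      have h1 : D ≤ N ^ ((q - 1) / q) := by
        have h2 : N⁻¹ ≤ θ := by
          rw [hθ, inv_eq_one_div]
          gcongr
        have h3 : (1 - q) / q ≤ 0 := div_nonpos_of_nonpos_of_nonneg (by linarith) hq0.le
        have h4 := Real.rpow_le_rpow_of_nonpos (inv_pos.2 hNpos) h2 h3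
        rw [Real.inv_rpow hN0, ← Real.rpow_neg hN0] at h4
        have : -((1 - q) / q) = (q - 1) / q := by ring
        rwa [this] at h4
      calc D * n ≤ N ^ ((q - 1) / q) * N ^ (1 / q) := by gcongr
        _ = N := by
            rw [← Real.rpow_add hNpos]
            have : (q - 1) / q + 1 / q = 1 := by field_simp; ring
            rw [this, Real.rpow_one]
    -- Since `D * θ = θ^(1/q)` and `N * θ = M`, the product is `M^(1/q)`.
    have hnDθ : n * (D * θ) ≤ M := by
      have h1 : D * θ = θ ^ (1 / q) := by
        have h2 : θ ^ ((1 - q) / q + 1) = D * θ := by rw [Real.rpow_add hθ0, Real.rpow_one]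
        rw [← h2]
        congr 1
        field_simp
        ring
      have h3 : N * θ = M := by rw [hθ]; field_simp
      rw [h1, hn, ← Real.mul_rpow hN0 hθ0.le, h3]
      calc M ^ (1 / q) ≤ M ^ (1 : ℝ) :=
            Real.rpow_le_rpow_of_exponent_le hM1 (by rw [div_le_one hq0]; exact hq)
        _ = M := Real.rpow_one M
    set Y := min (min (R₁ * N) (R₂ * N)) (S * n) with hY
    have hB' := min_rate_le hR₁0 hR₂0 hS0 hN1 hn1
    rw [← hY] at hB'
    have hCM : 1 ≤ C ^ 2 := one_le_pow₀ hC
    have hY0 : 0 ≤ Y := le_min (le_min (by positivity) (by positivity)) (by positivity)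
    -- Rates of different instances cannot be added, so `r` is the largest of those available; each
    -- summand of the target is then at most a multiple of `r`.
    obtain ⟨r, hr, hrA, hrN, hrY⟩ : ∃ r, HasHardInstance.{u} ε Δ L₁ L₂ p q σ₁ σ₂ r ∧
        min R₁ R₂ ≤ 16 * C ^ 2 * r ∧ N ≤ 2 * M * r ∧ Y ≤ 32 * C ^ 2 * M * r := by
      obtain ⟨r₀, hr₀, hA₀, hN₀⟩ : ∃ r, HasHardInstance.{u} ε Δ L₁ L₂ p q σ₁ σ₂ r ∧
          min R₁ R₂ ≤ 16 * C ^ 2 * r ∧ N ≤ 2 * M * r := by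
        have ha : min R₁ R₂ = 16 * C ^ 2 * (min R₁ R₂ / (16 * C ^ 2)) := by field_simp
        have hb : N = 2 * M * (N / (2 * M)) := by field_simp
        rcases le_total (min R₁ R₂ / (16 * C ^ 2)) (N / (2 * M)) with h | h
        · exact ⟨_, hshort, ha.le.trans (by gcongr), hb.le⟩
        · exact ⟨_, hdet, ha.le, hb.le.trans (by gcongr)⟩
      have hr₀0 : 0 ≤ r₀ := by
        by_contra hneg
        rw [not_le] at hneg
        have : 2 * M * r₀ < 0 := mul_neg_of_pos_of_neg (by positivity) hneg
        linarith
      by_cases hcase : σ₂ = 0 ∨ S < 8 * C ^ 2 * D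
      · refine ⟨r₀, hr₀, hA₀, hN₀, ?_⟩
        have hSn : S * n ≤ 8 * C ^ 2 * N := by
          rcases hcase with h | h
          · rw [hS, h, zero_mul, zero_div, zero_mul]
            positivity
          · calc S * n ≤ 8 * C ^ 2 * D * n := by gcongr
              _ = 8 * C ^ 2 * (D * n) := by ring
              _ ≤ 8 * C ^ 2 * N := by gcongr
        calc Y ≤ 8 * C ^ 2 * N := (min_le_right _ _).trans hSn
          _ ≤ 8 * C ^ 2 * (2 * M * r₀) := by gcongr
          _ = 16 * C ^ 2 * M * r₀ := by ring
          _ ≤ 32 * C ^ 2 * M * r₀ := by gcongr; norm_num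
      · push Not at hcase
        have hnoisy := hasHardInstance_noisy.{u} hC hchain hε hΔ hL₁ hL₂ hp hq
          (lt_of_le_of_ne hσ₂ (Ne.symm hcase.1)) hA hB hθ0 hθ1 hD hcase.2 hgrad
        have hYle : Y / M ≤ min (min (R₁ / θ) (R₂ / θ)) (S / (D * θ)) := by
          have hdiv : ∀ R : ℝ, R / θ = R * N / M := by
            intro R; rw [hθ]; field_simp
          refine le_min (le_min ?_ ?_) ?_
          · rw [hdiv]
            exact div_le_div_of_nonneg_right ((min_le_left _ _).trans (min_le_left _ _))
              (by positivity)
          · rw [hdiv]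
            exact div_le_div_of_nonneg_right ((min_le_left _ _).trans (min_le_right _ _))
              (by positivity)
          · rw [div_le_div_iff₀ (by positivity) (by positivity)]
            calc Y * (D * θ) ≤ S * n * (D * θ) := by gcongr; exact min_le_right _ _
              _ = S * (n * (D * θ)) := by ring
              _ ≤ S * M := by gcongr
        set r₁ := min (min (R₁ / θ) (R₂ / θ)) (S / (D * θ)) / (32 * C ^ 2) with hr₁
        have hY₁ : Y ≤ 32 * C ^ 2 * M * r₁ := by
          rw [div_le_iff₀ (by positivity)] at hYle
          have : 32 * C ^ 2 * M * r₁ = min (min (R₁ / θ) (R₂ / θ)) (S / (D * θ)) * M := by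
            rw [hr₁]; field_simp
          rw [this]
          exact hYle
        rcases le_total r₀ r₁ with h | h
        · exact ⟨r₁, hnoisy, hA₀.trans (by gcongr), hN₀.trans (by gcongr), hY₁⟩
        · exact ⟨r₀, hr₀, hA₀, hN₀, hY₁.trans (by gcongr)⟩
    refine hr.mono ?_
    have hr0 : 0 ≤ r := by
      by_contra hneg
      rw [not_le] at hneg
      have : 2 * M * r < 0 := mul_neg_of_pos_of_neg (by positivity) hneg
      linarith
    have hCMr : C ^ 2 * r ≤ C ^ 2 * M * r := by
      rw [mul_assoc (C ^ 2) M r]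
      gcongr
      exact le_mul_of_one_le_left hr0 hM1
    have hMr : M * r ≤ C ^ 2 * M * r := by
      rw [mul_assoc]
      exact le_mul_of_one_le_left (by positivity) hCM
    -- The multiples add up to at most `16 + 2·32 + 2 = 82` times `C² M r`.
    have htot := hB'.trans (show min R₁ R₂ + 2 * Y + N ≤ 100 * C ^ 2 * M * r by linarith)
    rw [one_div, inv_mul_le_iff₀ (by positivity)]
    exact htot

end Rates

end

/-! ### The theorem -/

theorem theorem3 :
    ∃ c₁ : ℝ, 0 < c₁ ∧
      ∀ p q : ℝ, 1 < p → p ≤ 2 → 1 ≤ q → q ≤ 2 →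
        ∃ c : ℝ, 0 < c ∧
          ∀ (K : ℕ) (Δ L₁ L₂ σ₁ σ₂ ε : ℝ), 1 ≤ K → 0 < Δ → 0 < L₁ → 0 < L₂ →
            0 ≤ σ₁ → 0 ≤ σ₂ → 0 < ε →
            ε ≤ c₁ * min (Real.sqrt (L₁ * Δ)) (L₂ ^ (1 / 3 : ℝ) * Δ ^ (2 / 3 : ℝ)) →
              ENNReal.ofReal (c * lowerBoundRate ε Δ L₁ L₂ p q σ₁ σ₂)
                  ≤ complexityZR.{u} K ε Δ L₁ L₂ p q σ₁ σ₂ ∧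
              ∀ A : (d : ℕ) → BatchAlgorithm.{u} d K, (∀ d, (A d).ZeroRespecting) →
                ∃ (d : ℕ) (F : Vec d → ℝ) (O : StochOracle F),
                  1 ≤ d ∧ SmoothClass Δ L₁ L₂ F ∧ O.GradBCM p σ₁ ∧ O.HessBCM q σ₂ ∧
                  ENNReal.ofReal (c * lowerBoundRate ε Δ L₁ L₂ p q σ₁ σ₂)
                    ≤ (A d).rounds O ε := by
  obtain ⟨C, hC, hchain⟩ := exists_zeroChain
  have hC0 : 0 < C := by linarith
  refine ⟨1 / (4 * C ^ 2), by positivity, fun p q hp _ hq _ =>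
    ⟨1 / (100 * C ^ 2 * 4 ^ (p / (p - 1))), by positivity, ?_⟩⟩
  intro K Δ L₁ L₂ σ₁ σ₂ ε _ hΔ hL₁ hL₂ hσ₁ hσ₂ hε hsmall
  rw [one_div, ← div_eq_inv_mul, le_div_iff₀ (by positivity)] at hsmall
  have hC2 : 1 ≤ C ^ 2 := one_le_pow₀ hC
  -- Squaring the smallness condition here, and cubing it for `hB`, gives higher powers of `4 * C ^
  -- 2` than needed; the excess is dropped since `4 * C ^ 2 ≥ 1`.
  have hA : 4 * C ^ 2 * ε ^ 2 ≤ L₁ * Δ := by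
    have h := pow_le_pow_left₀ (by positivity) (hsmall.trans (min_le_left _ _)) 2
    rw [Real.sq_sqrt (by positivity)] at h
    refine le_trans ?_ h
    rw [mul_pow, mul_comm]
    gcongr
    nlinarith
  have hB : 4 * C ^ 2 * (ε * √ε) ≤ √L₂ * Δ := by
    have h := pow_le_pow_left₀ (by positivity) (hsmall.trans (min_le_right _ _)) 3
    have e1 : (L₂ ^ (1 / 3 : ℝ)) ^ 3 = L₂ := by
      rw [← Real.rpow_natCast, ← Real.rpow_mul hL₂.le]; norm_num
    have e2 : (Δ ^ (2 / 3 : ℝ)) ^ 3 = Δ ^ 2 := by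
      rw [← Real.rpow_natCast, ← Real.rpow_mul hΔ.le, ← Real.rpow_natCast]; norm_num
    rw [mul_pow, mul_pow (L₂ ^ (1 / 3 : ℝ)), e1, e2] at h
    refine (sq_le_sq₀ (by positivity) (by positivity)).1 ?_
    rw [mul_pow, mul_pow √L₂, mul_pow ε, Real.sq_sqrt hε.le, Real.sq_sqrt hL₂.le]
    refine le_trans ?_ h
    have h4 : (4 * C ^ 2) ^ 2 ≤ (4 * C ^ 2) ^ 3 :=
      pow_le_pow_right₀ (by linarith) (by norm_num)
    calc (4 * C ^ 2) ^ 2 * (ε ^ 2 * ε) = ε ^ 3 * (4 * C ^ 2) ^ 2 := by ring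
      _ ≤ ε ^ 3 * (4 * C ^ 2) ^ 3 := by gcongr
  -- The instance depends neither on the algorithm nor on `K`, so it serves both conclusions.
  obtain ⟨d, F, O, hd, hF, hg, hh, hr⟩ := hasHardInstance_lowerBoundRate.{u} (p := p) (q := q)
    hC hchain hε hΔ hL₁ hL₂ hp hq hσ₁ hσ₂ hA hB
  refine ⟨?_, fun A hz => ⟨d, F, O, hd, hF, hg, hh, hr K (A d) (hz d)⟩⟩
  unfold complexityZR
  refine le_iSup_of_le d <| le_iSup_of_le hd <| le_iSup_of_le F <| le_iSup_of_le hF <|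
    le_iSup_of_le O <| le_iSup_of_le ⟨hg, hh⟩ <| le_iInf₂ fun A hz => hr K A hz
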